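/- Let $(\Omega,\mathcal F,P)$ be a probability space with a nondecreasing sequence $\{\mathcal F_n\}_{n\ge0}$ of sub-$\sigma$-algebras such that $\mathcal F=\sigma(\bigcup_n\mathcal F_n)$ and $\mathcal F_0=\{\emptyset,\Omega\}$. A set $B\in\mathcal F_n$ is an atom of $\mathcal F_n$ if every $A\subset B$ with $A\in\mathcal F_n$ satisfies $P(A)=P(B)$ or $P(A)=0$; assume that every $\mathcal F_n$ is generated by countably many of its atoms, and let $A(\mathcal F_n)$ denote the set of atoms of $\mathcal F_n$ of positive probability. Write $E$ for the expectation and $E_n$ for the conditional expectation given $\mathcal F_n$. Assume that the filtration is regular: for some $R\ge2$, every nonnegative martingale $(f_n)_{n\ge0}$ relative to $\{\mathcal F_n\}$ satisfies $f_n\le R f_{n-1}$ a.s. for all $n\ge1$. All functions are $\mathcal F$-measurable, with values in $\mathbb R$ (or all in $\mathbb C$), and functions that agree a.s. are identified. For $\phi:(0,1]\to(0,\infty)$ and $f\in L_1$ put $$\|f\|_{\mathcal L_{1,\phi}}=\sup_{n\ge0}\ \sup_{B\in A(\mathcal F_n)}\frac1{\phi(P(B))}\,\frac1{P(B)}\int_B|f-E_nf|\,dP,\qquad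 \mathcal L_{1,\phi}=\{f\in L_1:\|f\|_{\mathcal L_{1,\phi}}<\infty\}.$$ Let $\widetilde{\mathrm{BMO}}$ be the set of all $f\in L_1$ with $\|f\|_{\widetilde{\mathrm{BMO}}}:=\|f\|_{\mathcal L_{1,1}}+|Ef|<\infty$, where $\mathcal L_{1,1}$ is the case $\phi\equiv1$. Let $\mathrm{PWM}(\widetilde{\mathrm{BMO}})$ be the set of all functions $g$ such that $fg\in\widetilde{\mathrm{BMO}}$ for every $f\in\widetilde{\mathrm{BMO}}$, and for such $g$ let $$\|g\|_{Op}=\sup_{f\not\equiv0}\frac{\|fg\|_{\widetilde{\mathrm{BMO}}}}{\|f\|_{\widetilde{\mathrm{BMO}}}},$$ where $f$ runs over $\widetilde{\mathrm{BMO}}$. Then, with $\psi(r)=1/\log(e/r)$, $$\mathrm{PWM}(\widetilde{\mathrm{BMO}})=\mathcal L_{1,\psi}\cap L_\infty .$$ Moreover, $\|g\|_{Op}$ is equivalent to $\|g\|_{\mathcal L_{1,\psi}}+\|g\|_{L_\infty}$: there is a constant $C>0$, depending only on $R$, such that for all $g\in\mathrm{PWM}(\widetilde{\mathrm{BMO}})$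 $$\|g\|_{Op}\le C\left(\|g\|_{\mathcal L_{1,\psi}}+\|g\|_{L_\infty}\right)\quad\text{and}\quad \|g\|_{\mathcal L_{1,\psi}}+\|g\|_{L_\infty}\le C\,\|g\|_{Op}.$$ -/

import Mathlib

open MeasureTheory
open scoped ENNReal NNReal

namespace MartingaleCampanato

/-- `B` is an `(m, P)`-atom: `B ∈ m`, and every `A ⊆ B` with `A ∈ m` satisfies
`P A = P B` or `P A = 0`. -/
def IsAtomOf {Ω : Type*} {mΩ : MeasurableSpace Ω} (P : Measure Ω) (m : MeasurableSpace Ω)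
    (B : Set Ω) : Prop :=
  MeasurableSet[m] B ∧ ∀ A : Set Ω, A ⊆ B → MeasurableSet[m] A → P A = P B ∨ P A = 0

/-- The σ-algebra `m` is generated by countably many `(m, P)`-atoms. -/
def GeneratedByCountableAtoms {Ω : Type*} {mΩ : MeasurableSpace Ω} (P : Measure Ω)
    (m : MeasurableSpace Ω) : Prop :=
  ∃ S : Set (Set Ω), S.Countable ∧ (∀ B ∈ S, IsAtomOf P m B) ∧ m = MeasurableSpace.generateFrom S

/-- The filtration is regular with constant `R`: `f_n ≤ R f_{n-1}` a.s. for all nonnegative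
martingales. (For `n = 0`, with the convention `ℱ_{-1} = ℱ_0`, the inequality is trivial when
`1 ≤ R`.) -/
def IsRegularWith {Ω : Type*} {mΩ : MeasurableSpace Ω} (P : Measure Ω) (ℱ : Filtration ℕ mΩ)
    (R : ℝ) : Prop :=
  ∀ f : ℕ → Ω → ℝ, Martingale f ℱ P → (∀ n, 0 ≤ᵐ[P] f n) →
    ∀ n, ∀ᵐ ω ∂P, f (n + 1) ω ≤ R * f n ω

noncomputable section

/-- The Campanato seminorm, with values in `[0, ∞]`: the supremum over all `n` and all atoms `B` of
`ℱ n` (of positive probability, since one divides by `P B`) of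
`φ(P B)⁻¹ * ((P B)⁻¹ * ∫_B |f - E_n f|^p dP)^(1/p)`. Only used for integrable `f`. -/
def campanatoSeminorm {𝕜 Ω : Type*} [RCLike 𝕜] {mΩ : MeasurableSpace Ω} (P : Measure Ω)
    (ℱ : Filtration ℕ mΩ) (p : ℝ) (φ : ℝ → ℝ) (f : Ω → 𝕜) : ℝ≥0∞ :=
  ⨆ (n : ℕ) (B : Set Ω) (_ : IsAtomOf P (ℱ n) B) (_ : P B ≠ 0),
    (ENNReal.ofReal (φ (P.real B)))⁻¹ *
      ((P B)⁻¹ * ∫⁻ ω in B, ‖f ω - (P[f | ℱ n]) ω‖ₑ ^ p ∂P) ^ (1 / p)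

/-- The norm `‖f‖ + |E f|` with the Campanato seminorm as first term. -/
def campanatoNorm {𝕜 Ω : Type*} [RCLike 𝕜] {mΩ : MeasurableSpace Ω} (P : Measure Ω)
    (ℱ : Filtration ℕ mΩ) (p : ℝ) (φ : ℝ → ℝ) (f : Ω → 𝕜) : ℝ≥0∞ :=
  campanatoSeminorm P ℱ p φ f + ‖∫ ω, f ω ∂P‖ₑ

/-- The Campanato space `𝓛_{p,φ}` as a set of (a.e. strongly measurable) functions. -/
def campanato (𝕜 : Type*) {Ω : Type*} [RCLike 𝕜] {mΩ : MeasurableSpace Ω} (P : Measure Ω)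
    (ℱ : Filtration ℕ mΩ) (p : ℝ) (φ : ℝ → ℝ) : Set (Ω → 𝕜) :=
  {f | Integrable f P ∧ campanatoSeminorm P ℱ p φ f < ∞}

/-- The normed Campanato space as a set of functions. -/
def campanatoN (𝕜 : Type*) {Ω : Type*} [RCLike 𝕜] {mΩ : MeasurableSpace Ω} (P : Measure Ω)
    (ℱ : Filtration ℕ mΩ) (p : ℝ) (φ : ℝ → ℝ) : Set (Ω → 𝕜) :=
  {f | Integrable f P ∧ campanatoNorm P ℱ p φ f < ∞}

/-- The norm of `BMO~`: the case `p = 1`, `φ ≡ 1`. -/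
def bmoNorm {𝕜 Ω : Type*} [RCLike 𝕜] {mΩ : MeasurableSpace Ω} (P : Measure Ω)
    (ℱ : Filtration ℕ mΩ) (f : Ω → 𝕜) : ℝ≥0∞ :=
  campanatoNorm P ℱ 1 (fun _ => 1) f

/-- The space `BMO~`: the case `p = 1`, `φ ≡ 1`. -/
def bmoN (𝕜 : Type*) {Ω : Type*} [RCLike 𝕜] {mΩ : MeasurableSpace Ω} (P : Measure Ω)
    (ℱ : Filtration ℕ mΩ) : Set (Ω → 𝕜) :=
  campanatoN 𝕜 P ℱ 1 (fun _ => 1)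

/-- The pointwise multipliers on a set `X` of functions: the (a.e. strongly) measurable `g` with
`f g ∈ X` for all `f ∈ X`. -/
def pwm {𝕜 Ω : Type*} [RCLike 𝕜] {mΩ : MeasurableSpace Ω} (P : Measure Ω) (X : Set (Ω → 𝕜)) :
    Set (Ω → 𝕜) :=
  {g | AEStronglyMeasurable g P ∧ ∀ f ∈ X, f * g ∈ X}

/-- The operator norm, in `[0, ∞]`, of multiplication by `g` on the space `X` with norm `N`:
the supremum of `N (f g) / N f` over the `f ∈ X` that are not a.s. zero. -/
def opNorm {𝕜 Ω : Type*} [RCLike 𝕜] {mΩ : MeasurableSpace Ω} (P : Measure Ω) (X : Set (Ω → 𝕜))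
    (N : (Ω → 𝕜) → ℝ≥0∞) (g : Ω → 𝕜) : ℝ≥0∞ :=
  ⨆ (f : Ω → 𝕜) (_ : f ∈ X) (_ : ¬ f =ᵐ[P] 0), N (f * g) / N f

/-- `L_∞` as a set of functions. -/
def Linfty (𝕜 : Type*) {Ω : Type*} [RCLike 𝕜] {mΩ : MeasurableSpace Ω} (P : Measure Ω) :
    Set (Ω → 𝕜) :=
  {g | MemLp g ∞ P}

/-- `ψ(r) = 1 / log (e / r)`, used for `r ∈ (0, 1]`. -/
def psi (r : ℝ) : ℝ := 1 / Real.log (Real.exp 1 / r)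

end

end MartingaleCampanato

/-! On an atom `B` the conditional expectation is the average over `B`, so every seminorm reduces to
mean oscillations `osc` over atoms of positive measure.

Sufficiency: with `a`, `b` the averages of `f`, `g` over `B`, write `f g - a b = g (f - a) + a (g -
b)`. The first term is controlled by the sup norm of `g`. In the second, `a` grows at most like `log
(e / P B)` (`norm_setAverage_le_log`): by regularity each proper step from an atom to a child
shrinks the measure by a fixed factor and moves the average by at most `R` times the oscillation
bound. The weight `psi` absorbs exactly this growth (`mul_mem_bmoN`).

Necessity: a multiplier is automatically bounded, by a closed graph argument in `L¹`
(`exists_bmoNorm_mul_le`). Two families of test functions with uniformly bounded norm then suffice.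
Indicators of atoms bound the averages of `g` over atoms (`norm_setAverage_le_of_multiplier`), hence
`g` itself by martingale convergence. A function equal to `log (e / P B)` on `B`
(`exists_log_function`) acts on `B` as a large scalar, which forces the oscillation of `g` over `B`
to be of order `psi (P B)` (`osc_le_mul_psi_of_multiplier`). -/

namespace MartingaleCampanato

/-! ### Closed graph theorem for spaces cut out by a family of operators -/

section ClosedGraph

open Filter Topology

variable {E ι : Type*} [NormedAddCommGroup E] [NormedSpace ℝ E] {F : ι → Type*}
  [∀ i, NormedAddCommGroup (F i)] [∀ i, NormedSpace ℝ (F i)]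

/-- The subspace of vectors on which the family `T` is pointwise bounded. -/
def pointwiseBounded (T : ∀ i, E →L[ℝ] F i) : Submodule ℝ E where
  carrier := {x | BddAbove (Set.range fun i => ‖T i x‖)}
  zero_mem' := ⟨0, by rintro _ ⟨i, rfl⟩; simp⟩
  add_mem' := by
    rintro x y ⟨a, ha⟩ ⟨b, hb⟩
    refine ⟨a + b, ?_⟩
    rintro _ ⟨i, rfl⟩
    simp only [map_add]
    exact (norm_add_le _ _).trans (add_le_add (ha ⟨i, rfl⟩) (hb ⟨i, rfl⟩))
  smul_mem' := by
    rintro c x ⟨a, ha⟩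
    refine ⟨‖c‖ * a, ?_⟩
    rintro _ ⟨i, rfl⟩
    simp only [map_smul, norm_smul]
    exact mul_le_mul_of_nonneg_left (ha ⟨i, rfl⟩) (norm_nonneg _)

/-- The graph of the family `T` in `E × ℓ^∞(F)`. -/
def graphSubmodule (T : ∀ i, E →L[ℝ] F i) : Submodule ℝ (E × lp F ∞) where
  carrier := {p | ∀ i, p.2 i = T i p.1}
  zero_mem' := by intro i; simp
  add_mem' := by
    intro p q hp hq i
    simp [hp i, hq i]
  smul_mem' := by
    intro c p hp i
    simp [hp i]

theorem isClosed_graphSubmodule (T : ∀ i, E →L[ℝ] F i) :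
    IsClosed (graphSubmodule T : Set (E × lp F ∞)) := by
  have : (graphSubmodule T : Set (E × lp F ∞)) = ⋂ i, {p | p.2 i = T i p.1} := by
    ext p
    rw [Set.mem_iInter]
    rfl
  rw [this]
  exact isClosed_iInter fun i => isClosed_eq
    ((lp.evalCLM ℝ F ∞ i).continuous.comp continuous_snd) ((T i).continuous.comp continuous_fst)

theorem mem_pointwiseBounded_of_mem_graph {T : ∀ i, E →L[ℝ] F i} {p : E × lp F ∞}
    (hp : p ∈ graphSubmodule T) : p.1 ∈ pointwiseBounded T := by
  refine ⟨‖p.2‖, ?_⟩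
  rintro _ ⟨i, rfl⟩
  simp only [← hp i]
  exact lp.norm_apply_le_norm ENNReal.top_ne_zero p.2 i

/-- A vector on which `T` is bounded, viewed in the graph. -/
def toGraph (T : ∀ i, E →L[ℝ] F i) (x : pointwiseBounded T) : graphSubmodule T :=
  ⟨(x, ⟨fun i => T i x, memℓp_infty x.2⟩), fun _ => rfl⟩

/-- The map induced on the graph by an endomorphism. -/
def graphMap (T : ∀ i, E →L[ℝ] F i) (S : pointwiseBounded T →ₗ[ℝ] pointwiseBounded T) :
    graphSubmodule T →ₗ[ℝ] graphSubmodule T where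
  toFun p := toGraph T (S ⟨p.1.1, mem_pointwiseBounded_of_mem_graph p.2⟩)
  map_add' p q := by
    have h : S ⟨(p + q).1.1, mem_pointwiseBounded_of_mem_graph (p + q).2⟩ =
        S ⟨p.1.1, mem_pointwiseBounded_of_mem_graph p.2⟩ +
          S ⟨q.1.1, mem_pointwiseBounded_of_mem_graph q.2⟩ := by
      rw [← map_add]; rfl
    rw [h]
    refine Subtype.ext (Prod.ext rfl (lp.ext (funext fun i => ?_)))
    exact map_add (T i) _ _
  map_smul' c p := by
    have h : S ⟨(c • p).1.1, mem_pointwiseBounded_of_mem_graph (c • p).2⟩ =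
        c • S ⟨p.1.1, mem_pointwiseBounded_of_mem_graph p.2⟩ := by
      rw [← map_smul]; rfl
    rw [h]
    refine Subtype.ext (Prod.ext rfl (lp.ext (funext fun i => ?_)))
    exact map_smul (T i) _ _

/-- Closed graph theorem for an endomorphism of the space of vectors on which a family of
operators is bounded, the graph being closed for the norm of the ambient space. -/
theorem exists_bound_of_closed_graph [CompleteSpace E] [∀ i, CompleteSpace (F i)]
    (T : ∀ i, E →L[ℝ] F i) (S : pointwiseBounded T →ₗ[ℝ] pointwiseBounded T)
    (hS : ∀ (u : ℕ → pointwiseBounded T) (x y : pointwiseBounded T),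
      Tendsto (fun n => (u n : E)) atTop (𝓝 x) → Tendsto (fun n => (S (u n) : E)) atTop (𝓝 y) →
        (y : E) = S x) :
    ∃ K, 0 ≤ K ∧ ∀ (x : pointwiseBounded T) (M : ℝ), 0 ≤ M → ‖(x : E)‖ ≤ M →
      (∀ i, ‖T i x‖ ≤ M) → ‖(S x : E)‖ ≤ K * M ∧ ∀ i, ‖T i (S x)‖ ≤ K * M := by
  -- The graph, with the product norm, stands in for the space normed by `‖x‖` and `sup ‖T i x‖`;
  -- being closed in a Banach space it is complete.
  have : CompleteSpace (graphSubmodule T) := (isClosed_graphSubmodule T).completeSpace_coe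
  have hcont : Continuous (graphMap T S) := by
    refine LinearMap.continuous_of_seq_closed_graph _ fun u x y hu hy => ?_
    have hu' : Tendsto (fun n => (u n).1.1) atTop (𝓝 x.1.1) :=
      (continuous_fst.comp continuous_subtype_val).continuousAt.tendsto.comp hu
    have hy' : Tendsto (fun n => ((graphMap T S) (u n)).1.1) atTop (𝓝 y.1.1) :=
      (continuous_fst.comp continuous_subtype_val).continuousAt.tendsto.comp hy
    -- Convergence in the graph norm implies convergence in `E`, so closedness in the weaker norm is
    -- enough; the second coordinates are determined by the first.
    have h1 : y.1.1 = ((graphMap T S) x).1.1 :=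
      hS (fun n => ⟨(u n).1.1, mem_pointwiseBounded_of_mem_graph (u n).2⟩)
        ⟨x.1.1, mem_pointwiseBounded_of_mem_graph x.2⟩
        ⟨y.1.1, mem_pointwiseBounded_of_mem_graph y.2⟩ hu' hy'
    refine Subtype.ext (Prod.ext h1 (lp.ext (funext fun i => ?_)))
    rw [y.2 i, ((graphMap T S) x).2 i, h1]
  let L : graphSubmodule T →L[ℝ] graphSubmodule T := ⟨graphMap T S, hcont⟩
  refine ⟨‖L‖, L.opNorm_nonneg, fun x M hM hx hT => ?_⟩
  have hp : ‖toGraph T x‖ ≤ M :=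
    max_le hx (lp.norm_le_of_forall_le hM hT)
  have h1 : ‖toGraph T (S x)‖ ≤ ‖L‖ * M :=
    (L.le_opNorm (toGraph T x)).trans (mul_le_mul_of_nonneg_left hp L.opNorm_nonneg)
  refine ⟨(norm_fst_le (toGraph T (S x)).1).trans h1, fun i => ?_⟩
  exact (lp.norm_apply_le_norm ENNReal.top_ne_zero (toGraph T (S x)).1.2 i).trans
    ((norm_snd_le (toGraph T (S x)).1).trans h1)

end ClosedGraph

/-! ### Atoms, averages and mean oscillation -/

variable {𝕜 Ω : Type*} [RCLike 𝕜] {m m' mΩ : MeasurableSpace Ω} {P : Measure Ω}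
  {ℱ : Filtration ℕ mΩ} {A B : Set Ω}

/-- An `(m, P)`-atom of positive measure. -/
def IsPosAtom (P : Measure Ω) (m : MeasurableSpace Ω) (B : Set Ω) : Prop :=
  IsAtomOf P m B ∧ P B ≠ 0

/-- The mean oscillation of `f` over `B`. -/
noncomputable def osc (P : Measure Ω) (B : Set Ω) (f : Ω → 𝕜) : ℝ :=
  ⨍ ω in B, ‖f ω - ⨍ x in B, f x ∂P‖ ∂P

/-- The generators need not cover `Ω`. The part they miss is itself an atom, because the sets that
contain it or are disjoint from it form a σ-algebra containing all generators. -/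
theorem GeneratedByCountableAtoms.exists_cover (h : GeneratedByCountableAtoms P m) :
    ∃ S : Set (Set Ω), S.Countable ∧ (∀ B ∈ S, IsAtomOf P m B) ∧ ⋃₀ S = Set.univ := by
  obtain ⟨S, hS, hSa, rfl⟩ := h
  set D : Set Ω := (⋃₀ S)ᶜ with hD
  have hDm : MeasurableSet[MeasurableSpace.generateFrom S] D :=
    (MeasurableSet.sUnion hS fun B hB => MeasurableSpace.measurableSet_generateFrom hB).compl
  have key : ∀ A, MeasurableSet[MeasurableSpace.generateFrom S] A → D ⊆ A ∨ D ⊆ Aᶜ := by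
    intro A hA
    induction A, hA using MeasurableSpace.generateFrom_induction with
    | hC t ht _ =>
      refine Or.inr fun x hx hxt => hx ⟨t, ht, hxt⟩
    | empty => exact Or.inr (by simp)
    | compl t _ ih => rw [compl_compl]; exact ih.symm
    | iUnion s _ ih =>
      by_cases h : ∃ i, D ⊆ s i
      · obtain ⟨i, hi⟩ := h
        exact Or.inl (hi.trans (Set.subset_iUnion s i))
      · push Not at h
        right
        rw [Set.compl_iUnion]
        exact Set.subset_iInter fun i => (ih i).resolve_left (h i)
  refine ⟨insert D S, hS.insert D, ?_, ?_⟩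
  · rintro B (rfl | hB)
    · refine ⟨hDm, fun A hAD hA => ?_⟩
      rcases key A hA with h | h
      · exact Or.inl (by rw [hAD.antisymm h])
      · right
        have : A = ∅ := by
          ext x
          simp only [Set.mem_empty_iff_false, iff_false]
          exact fun hx => h (hAD hx) hx
        simp [this]
    · exact hSa B hB
  · rw [Set.sUnion_insert, hD, Set.compl_union_self]

theorem GeneratedByCountableAtoms.exists_isPosAtom (h : GeneratedByCountableAtoms P m)
    (hA : P A ≠ 0) : ∃ B, IsPosAtom P m B ∧ P (A ∩ B) ≠ 0 := by
  obtain ⟨S, hS, hSa, hSu⟩ := h.exists_cover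
  by_contra! hcon
  apply hA
  have : A = ⋃ B ∈ S, A ∩ B := by
    rw [← Set.inter_iUnion₂, ← Set.sUnion_eq_biUnion, hSu, Set.inter_univ]
  rw [this, measure_biUnion_null_iff hS]
  intro B hB
  by_cases hB0 : P B = 0
  · exact measure_mono_null Set.inter_subset_right hB0
  · exact hcon B ⟨hSa B hB, hB0⟩

theorem IsPosAtom.measurableSet (hB : IsPosAtom P m B) : MeasurableSet[m] B := hB.1.1

theorem setAverage_mono_le {f g : Ω → ℝ} (hf : IntegrableOn f B P) (hg : IntegrableOn g B P)
    (h : f ≤ᵐ[P.restrict B] g) : ⨍ ω in B, f ω ∂P ≤ ⨍ ω in B, g ω ∂P := by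
  rw [setAverage_eq, setAverage_eq, smul_eq_mul, smul_eq_mul]
  exact mul_le_mul_of_nonneg_left (integral_mono_ae hf hg h) (inv_nonneg.2 measureReal_nonneg)

theorem norm_setAverage_le (f : Ω → 𝕜) : ‖⨍ ω in B, f ω ∂P‖ ≤ ⨍ ω in B, ‖f ω‖ ∂P := by
  rw [setAverage_eq, setAverage_eq, norm_smul, smul_eq_mul, Real.norm_of_nonneg (by positivity)]
  exact mul_le_mul_of_nonneg_left (norm_integral_le_integral_norm _)
    (inv_nonneg.2 measureReal_nonneg)

theorem setAverage_nonneg {f : Ω → ℝ} (h : ∀ ω, 0 ≤ f ω) : 0 ≤ ⨍ ω in B, f ω ∂P := by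
  rw [setAverage_eq, smul_eq_mul]
  exact mul_nonneg (inv_nonneg.2 measureReal_nonneg) (integral_nonneg h)

theorem osc_nonneg (f : Ω → 𝕜) : 0 ≤ osc P B f := setAverage_nonneg fun _ => norm_nonneg _

theorem IsPosAtom.eq_univ (h0 : ℱ 0 = ⊥) (hB : IsPosAtom P (ℱ 0) B) : B = Set.univ := by
  have h := hB.measurableSet
  rw [h0, MeasurableSpace.measurableSet_bot_iff] at h
  exact h.resolve_left fun h => hB.2 (by simp [h])

theorem osc_const_mul (c : 𝕜) (g : Ω → 𝕜) :
    osc P B (fun ω => c * g ω) = ‖c‖ * osc P B g := by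
  have h : ⨍ ω in B, c * g ω ∂P = c * ⨍ ω in B, g ω ∂P := by
    rw [setAverage_eq, integral_const_mul, setAverage_eq, mul_smul_comm]
  rw [osc, h]
  simp only [← mul_sub, norm_mul]
  rw [setAverage_eq, integral_const_mul, osc, setAverage_eq P (fun ω => ‖_‖), smul_eq_mul,
    smul_eq_mul]
  ring

theorem osc_congr {f g : Ω → 𝕜} (h : f =ᵐ[P.restrict B] g) : osc P B f = osc P B g := by
  rw [osc, average_congr h, osc]
  refine average_congr ?_
  filter_upwards [h] with ω hω
  rw [hω]

theorem norm_integral_le_of_bmoNorm_le {f : Ω → 𝕜} {K : ℝ} (hK : 0 ≤ K)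
    (h : bmoNorm P ℱ f ≤ ENNReal.ofReal K) : ‖∫ ω, f ω ∂P‖ ≤ K := by
  have h1 : ‖∫ ω, f ω ∂P‖ₑ ≤ ENNReal.ofReal K := le_add_self.trans h
  rwa [← ofReal_norm, ENNReal.ofReal_le_ofReal_iff hK] at h1

theorem setIntegral_indicator_mul (hB : MeasurableSet B) (hBA : P (B \ A) = 0) (g : Ω → 𝕜) :
    ∫ ω in A, (B.indicator (fun _ => (1 : 𝕜)) * g) ω ∂P = ∫ ω in B, g ω ∂P := by
  have : B.indicator (fun _ => (1 : 𝕜)) * g = B.indicator g := by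
    ext ω
    by_cases h : ω ∈ B <;> simp [h]
  rw [this, setIntegral_indicator hB]
  refine setIntegral_congr_set ?_
  rw [ae_eq_set]
  refine ⟨by rw [Set.sdiff_eq_empty.2 Set.inter_subset_right, measure_empty], ?_⟩
  rwa [Set.sdiff_inter_self_eq_sdiff]

section

variable [IsProbabilityMeasure P]

theorem IsPosAtom.real_pos (hB : IsPosAtom P m B) : 0 < P.real B :=
  ENNReal.toReal_pos hB.2 (measure_ne_top _ _)

theorem IsPosAtom.diff_null_or_inter_null (hm : m ≤ mΩ) (hB : IsPosAtom P m B)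
    (hA : MeasurableSet[m] A) : P (B \ A) = 0 ∨ P (B ∩ A) = 0 := by
  rcases hB.1.2 (B ∩ A) Set.inter_subset_left (hB.1.1.inter hA) with h | h
  · left
    have := measure_inter_add_sdiff (μ := P) B (hm _ hA)
    rw [h] at this
    exact (ENNReal.add_right_inj (measure_ne_top P B)).1 (this.trans (add_zero _).symm)
  · exact Or.inr h

theorem IsPosAtom.exists_parent (hm : m ≤ m') (hm' : m' ≤ mΩ)
    (h : GeneratedByCountableAtoms P m) (hB : IsPosAtom P m' B) :
    ∃ A, IsPosAtom P m A ∧ P (B \ A) = 0 := by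
  obtain ⟨A, hA, hBA⟩ := h.exists_isPosAtom hB.2
  exact ⟨A, hA, (hB.diff_null_or_inter_null hm' (hm _ hA.measurableSet)).resolve_right hBA⟩

/-- Every preimage under `h` has full or zero measure in the atom, and countably many measurable
sets separate the points of `𝕜`. -/
theorem IsPosAtom.ae_eq_const (hm : m ≤ mΩ) (hB : IsPosAtom P m B) {h : Ω → 𝕜}
    (hh : Measurable[m] h) : ∃ c, h =ᵐ[P.restrict B] fun _ => c := by
  refine Filter.exists_eventuallyEq_const_of_forall_separating MeasurableSet fun U hU => ?_
  rw [ae_restrict_iff' (hm _ hB.measurableSet), ae_restrict_iff' (hm _ hB.measurableSet)]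
  refine (hB.diff_null_or_inter_null hm (hh hU)).imp (fun h0 => ?_) fun h0 => ?_
  · rw [ae_iff]
    convert h0 using 2
    ext x
    simp
  · rw [ae_iff]
    convert h0 using 2
    ext x
    simp

theorem average_of_ae_eq_const (hB : P B ≠ 0) {f : Ω → 𝕜} {c : 𝕜}
    (h : f =ᵐ[P.restrict B] fun _ => c) : ⨍ ω in B, f ω ∂P = c := by
  rw [average_congr h]
  exact setAverage_const hB (measure_ne_top _ _) c

theorem IsPosAtom.condExp_ae_eq (hB : IsPosAtom P m B) (hm : m ≤ mΩ) {f : Ω → 𝕜}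
    (hf : Integrable f P) : P[f | m] =ᵐ[P.restrict B] fun _ => ⨍ ω in B, f ω ∂P := by
  obtain ⟨c, hc⟩ := hB.ae_eq_const hm (stronglyMeasurable_condExp (f := f) (μ := P)).measurable
  have h1 := average_of_ae_eq_const hB.2 hc
  rw [setAverage_eq, setIntegral_condExp hm hf hB.measurableSet, ← setAverage_eq] at h1
  rw [h1]
  exact hc

theorem norm_setAverage_sub_le (hB : P B ≠ 0) {f : Ω → 𝕜} (hf : IntegrableOn f B P) (c : 𝕜) :
    ‖⨍ ω in B, f ω ∂P - c‖ ≤ ⨍ ω in B, ‖f ω - c‖ ∂P := by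
  have h : ⨍ ω in B, (f ω - c) ∂P = ⨍ ω in B, f ω ∂P - c := by
    rw [setAverage_eq, integral_sub hf (integrable_const c), smul_sub, ← setAverage_eq,
      ← setAverage_eq, setAverage_const hB (measure_ne_top _ _)]
  rw [← h]
  exact norm_setAverage_le _

/-- The average is, up to the factor 2, as good a centre as any constant `c`, since it is itself
within the mean distance of `c`. -/
theorem osc_le (hB : P B ≠ 0) {f : Ω → 𝕜} (hf : IntegrableOn f B P) (c : 𝕜) :
    osc P B f ≤ 2 * ⨍ ω in B, ‖f ω - c‖ ∂P := by
  have hi : IntegrableOn (fun ω => ‖f ω - c‖) B P := (hf.sub (integrable_const c)).norm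
  set a := ⨍ ω in B, f ω ∂P with ha
  calc osc P B f ≤ ⨍ ω in B, (‖f ω - c‖ + ‖a - c‖) ∂P := by
        refine setAverage_mono_le (hf.sub (integrable_const a)).norm
          (hi.add (integrable_const _)) (Filter.Eventually.of_forall fun ω => ?_)
        calc ‖f ω - a‖ = ‖(f ω - c) - (a - c)‖ := by ring_nf
          _ ≤ _ := norm_sub_le _ _
    _ = ⨍ ω in B, ‖f ω - c‖ ∂P + ‖a - c‖ := by
        rw [setAverage_eq, integral_add hi (integrable_const _), smul_add, ← setAverage_eq,
          ← setAverage_eq, setAverage_const hB (measure_ne_top _ _)]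
    _ ≤ 2 * ⨍ ω in B, ‖f ω - c‖ ∂P := by
        have := norm_setAverage_sub_le hB hf c
        linarith

theorem IsPosAtom.campanato_term_eq (hB : IsPosAtom P m B) (hm : m ≤ mΩ) {f : Ω → 𝕜}
    (hf : Integrable f P) :
    ((P B)⁻¹ * ∫⁻ ω in B, ‖f ω - (P[f | m]) ω‖ₑ ^ (1 : ℝ) ∂P) ^ (1 / (1 : ℝ)) =
      ENNReal.ofReal (osc P B f) := by
  have h1 : ∫⁻ ω in B, ‖f ω - (P[f | m]) ω‖ₑ ^ (1 : ℝ) ∂P =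
      ENNReal.ofReal (∫ ω in B, ‖f ω - ⨍ x in B, f x ∂P‖ ∂P) := by
    have hi : Integrable (fun ω => f ω - ⨍ x in B, f x ∂P) (P.restrict B) :=
      hf.integrableOn.sub (integrable_const _)
    rw [ofReal_integral_norm_eq_lintegral_enorm hi]
    refine lintegral_congr_ae ?_
    filter_upwards [hB.condExp_ae_eq hm hf] with ω hω
    rw [hω, ENNReal.rpow_one]
  rw [h1, div_one, ENNReal.rpow_one, osc, setAverage_eq P (fun ω => ‖_‖), smul_eq_mul,
    ENNReal.ofReal_mul (inv_nonneg.2 measureReal_nonneg), ENNReal.ofReal_inv_of_pos hB.real_pos,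
    ofReal_measureReal]

theorem campanatoSeminorm_le_iff {φ : ℝ → ℝ} (hφ : ∀ r, 0 < r → r ≤ 1 → 0 < φ r) {f : Ω → 𝕜}
    (hf : Integrable f P) {M : ℝ} (hM : 0 ≤ M) :
    campanatoSeminorm P ℱ 1 φ f ≤ ENNReal.ofReal M ↔
      ∀ n B, IsPosAtom P (ℱ n) B → osc P B f ≤ M * φ (P.real B) := by
  simp only [campanatoSeminorm, iSup_le_iff]
  refine forall₂_congr fun n B => ?_
  rw [IsPosAtom, and_imp]
  refine forall₂_congr fun h1 h2 => ?_
  have hB : IsPosAtom P (ℱ n) B := ⟨h1, h2⟩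
  have hp := hφ _ hB.real_pos measureReal_le_one
  rw [hB.campanato_term_eq (ℱ.le n) hf, ← ENNReal.ofReal_inv_of_pos hp,
    ← ENNReal.ofReal_mul (by positivity), ENNReal.ofReal_le_ofReal_iff hM,
    inv_mul_le_iff₀ hp, mul_comm]

theorem isPosAtom_univ (h0 : ℱ 0 = ⊥) : IsPosAtom P (ℱ 0) Set.univ := by
  refine ⟨⟨MeasurableSet.univ, fun A _ hA => ?_⟩, by simp⟩
  rw [h0, MeasurableSpace.measurableSet_bot_iff] at hA
  rcases hA with rfl | rfl <;> simp

/-! ### Regularity and the logarithmic growth of averages -/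

/-- Apply regularity to the martingale of conditional expectations of the indicator of `A ∩ B`: at
time `n + 1` it equals 1 on that set, at time `n` it equals `P (A ∩ B) / P B` on `B`. -/
theorem IsRegularWith.measure_le {R : ℝ} (hR : IsRegularWith P ℱ R) {n : ℕ}
    (hB : IsPosAtom P (ℱ n) B) (hA : MeasurableSet[ℱ (n + 1)] A) (hAB : P (A ∩ B) ≠ 0) :
    P.real B ≤ R * P.real (A ∩ B) := by
  set S := A ∩ B with hS
  have hSn : MeasurableSet[ℱ (n + 1)] S :=
    hA.inter (ℱ.mono (Nat.le_succ n) _ hB.measurableSet)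
  have hSm : MeasurableSet S := ℱ.le _ _ hSn
  set f : Ω → ℝ := S.indicator fun _ => 1 with hf
  have hfi : Integrable f P := (integrable_const (1 : ℝ)).indicator hSm
  have h1 := hR _ (martingale_condExp f ℱ P)
    (fun n => condExp_nonneg (Filter.Eventually.of_forall
      fun ω => Set.indicator_nonneg (fun _ _ => zero_le_one) ω)) n
  rw [condExp_of_stronglyMeasurable (ℱ.le (n + 1)) (stronglyMeasurable_const.indicator hSn) hfi]
    at h1
  have h2 := hB.condExp_ae_eq (ℱ.le n) hfi
  have havg : ⨍ ω in B, f ω ∂P = (P.real B)⁻¹ * P.real S := by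
    rw [setAverage_eq, setIntegral_indicator hSm, smul_eq_mul, setIntegral_const, smul_eq_mul,
      mul_one, hS, Set.inter_comm A B, ← Set.inter_assoc, Set.inter_self]
  have h3 : ∀ᵐ ω ∂P.restrict S, 1 ≤ R * ((P.real B)⁻¹ * P.real S) := by
    filter_upwards [ae_restrict_of_ae h1, ae_restrict_of_ae_restrict_of_subset
      (Set.inter_subset_right : S ⊆ B) h2, ae_restrict_mem hSm] with ω h4 h5 h6
    rw [h5, havg] at h4
    simpa [hf, h6] using h4
  -- The inequality in `h3` does not depend on `ω`, so a single point of the non-null set `S`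
  -- suffices.
  have : NeZero (P.restrict S) := ⟨by rwa [Ne, Measure.restrict_eq_zero]⟩
  obtain ⟨-, h⟩ := h3.exists
  have hp := hB.real_pos
  rw [← mul_assoc, mul_comm R, mul_assoc, le_inv_mul_iff₀ hp, mul_one] at h
  exact h

/-- An atom of `ℱ (n + 1)` either coincides with its parent atom, or both the atom and its
complement in the parent have at least `1 / R` of the measure of the parent. -/
theorem IsPosAtom.exists_parent_of_regular {R : ℝ} {n : ℕ} (hA : IsPosAtom P (ℱ (n + 1)) A)
    (hgen : GeneratedByCountableAtoms P (ℱ n)) (hR : IsRegularWith P ℱ R) :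
    ∃ B, IsPosAtom P (ℱ n) B ∧ P (A \ B) = 0 ∧
      (A =ᵐ[P] B ∨ (P.real B ≤ R * P.real A ∧ P.real B ≤ R * P.real (B \ A))) := by
  obtain ⟨B, hB, hAB⟩ := hA.exists_parent (ℱ.mono (Nat.le_succ n)) (ℱ.le _) hgen
  refine ⟨B, hB, hAB, ?_⟩
  have h1 : P (A ∩ B) = P A := by
    rw [← measure_inter_add_sdiff A (ℱ.le _ _ hB.measurableSet), hAB, add_zero]
  rw [ae_eq_set]
  -- Both bounds are instances of `measure_le`, for `A` and for its complement; the latter needs `B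
  -- \ A` to be non-null.
  refine or_iff_not_imp_left.2 fun h => ⟨?_, ?_⟩
  · have := hR.measure_le hB hA.measurableSet (by rw [h1]; exact hA.2)
    rwa [measureReal_def P (A ∩ B), h1] at this
  · have h2 : Aᶜ ∩ B = B \ A := by rw [Set.inter_comm, Set.sdiff_eq]
    have := hR.measure_le hB hA.measurableSet.compl (by rw [h2]; exact fun h3 => h ⟨hAB, h3⟩)
    rwa [h2] at this

theorem measureReal_add_diff_of_null (hA : MeasurableSet A) (hAB : P (A \ B) = 0) :
    P.real A + P.real (B \ A) = P.real B := by
  have h1 : P (B ∩ A) = P A := measure_congr <| by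
    rw [ae_eq_set]
    refine ⟨by rw [Set.sdiff_eq_empty.2 Set.inter_subset_right, measure_empty], ?_⟩
    rwa [Set.sdiff_inter_self_eq_sdiff]
  rw [← measureReal_inter_add_sdiff (s := B) hA, measureReal_def P (B ∩ A), h1, measureReal_def]

theorem log_exp_one_div {r : ℝ} (hr : 0 < r) :
    Real.log (Real.exp 1 / r) = 1 - Real.log r := by
  rw [Real.log_div (Real.exp_pos 1).ne' hr.ne', Real.log_exp]

theorem psi_pos {r : ℝ} (hr : 0 < r) (hr1 : r ≤ 1) : 0 < psi r := by
  rw [psi, log_exp_one_div hr]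
  have := Real.log_nonpos hr.le hr1
  exact one_div_pos.2 (by linarith)

/-- Climb from `B` through its parents up to `Ω`. A step to an a.e. equal parent is free; a proper
step costs `R * M` and gains at least `log (R / (R - 1))` in `-log P`, so the number of proper steps
is paid for by the logarithm. -/
theorem norm_setAverage_le_log {R : ℝ} (hR2 : 2 ≤ R) (h0 : ℱ 0 = ⊥)
    (hgen : ∀ n, GeneratedByCountableAtoms P (ℱ n)) (hR : IsRegularWith P ℱ R) {f : Ω → 𝕜}
    (hf : Integrable f P) {M M' : ℝ} (hM : ∀ n B, IsPosAtom P (ℱ n) B → osc P B f ≤ M)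
    (hM' : ‖∫ ω, f ω ∂P‖ ≤ M') {n : ℕ} (hB : IsPosAtom P (ℱ n) B) :
    ‖⨍ ω in B, f ω ∂P‖ ≤ M' + R / Real.log (R / (R - 1)) * M * (-Real.log (P.real B)) := by
  have hM0 : 0 ≤ M := (osc_nonneg f).trans (hM 0 _ (isPosAtom_univ h0))
  induction n generalizing B with
  | zero =>
    obtain rfl := hB.eq_univ h0
    simpa [average_eq_integral] using hM'
  | succ n ih =>
    obtain ⟨A, hA, hBA, h⟩ := hB.exists_parent_of_regular (hgen n) hR
    rcases h with h | ⟨h1, h2⟩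
    · have := ih hA
      rwa [setAverage_congr h, measureReal_congr h]
    have hBm := ℱ.le _ _ hB.measurableSet
    have hadd := measureReal_add_diff_of_null hBm hBA
    have hpA := hA.real_pos
    have hpB := hB.real_pos
    set a := ⨍ ω in A, f ω ∂P with ha
    have hia : IntegrableOn (fun ω => ‖f ω - a‖) A P :=
      (hf.integrableOn.sub (integrable_const a)).norm
    have h3 : ‖⨍ ω in B, f ω ∂P - a‖ ≤ R * M := by
      refine (norm_setAverage_sub_le hB.2 hf.integrableOn a).trans ?_
      have h4 : ∫ ω in B, ‖f ω - a‖ ∂P ≤ ∫ ω in A, ‖f ω - a‖ ∂P :=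
        setIntegral_mono_set hia (Filter.Eventually.of_forall fun _ => norm_nonneg _)
          (ae_le_set.2 hBA)
      have h5 := hM n A hA
      rw [osc, setAverage_eq, smul_eq_mul, inv_mul_le_iff₀ hpA] at h5
      rw [setAverage_eq, smul_eq_mul, inv_mul_le_iff₀ hpB]
      calc _ ≤ P.real A * M := h4.trans h5
        _ ≤ R * P.real B * M := mul_le_mul_of_nonneg_right h1 hM0
        _ = _ := by ring
    -- The sibling part `A \ B` carries at least `P A / R`, which leaves `P B ≤ (1 - 1 / R) * P A`.
    have hlog : Real.log (R / (R - 1)) ≤ Real.log (P.real A) - Real.log (P.real B) := by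
      rw [← Real.log_div hpA.ne' hpB.ne']
      refine Real.log_le_log (div_pos (by linarith) (by linarith)) ?_
      rw [div_le_div_iff₀ (by linarith) hpB]
      nlinarith
    have hlog0 : 0 < Real.log (R / (R - 1)) :=
      Real.log_pos (by rw [lt_div_iff₀ (by linarith)]; linarith)
    have h6 : R * M ≤ R / Real.log (R / (R - 1)) * M *
        (Real.log (P.real A) - Real.log (P.real B)) := by
      calc R * M = R / Real.log (R / (R - 1)) * M * Real.log (R / (R - 1)) := by field_simp
        _ ≤ _ := mul_le_mul_of_nonneg_left hlog (by positivity)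
    have h7 := ih hA
    have h8 := norm_le_norm_add_norm_sub' (⨍ ω in B, f ω ∂P) a
    linarith

/-! ### Sufficiency: products with bounded functions in `𝓛_{1,ψ}` -/

theorem osc_mul_le (hB : P B ≠ 0) {f g : Ω → 𝕜} (hf : Integrable f P) (hg : Integrable g P)
    {G : ℝ} (hG : ∀ᵐ ω ∂P, ‖g ω‖ ≤ G) :
    osc P B (f * g) ≤ 2 * (G * osc P B f + ‖⨍ ω in B, f ω ∂P‖ * osc P B g) := by
  have hfg : Integrable (f * g) P := hf.mul_bdd hg.aestronglyMeasurable hG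
  set a := ⨍ ω in B, f ω ∂P with ha
  set b := ⨍ ω in B, g ω ∂P with hb
  have hi1 : IntegrableOn (fun ω => G * ‖f ω - a‖) B P :=
    (hf.integrableOn.sub (integrable_const a)).norm.const_mul G
  have hi2 : IntegrableOn (fun ω => ‖a‖ * ‖g ω - b‖) B P :=
    (hg.integrableOn.sub (integrable_const b)).norm.const_mul _
  refine (osc_le hB hfg.integrableOn (a * b)).trans (mul_le_mul_of_nonneg_left ?_ two_pos.le)
  calc ⨍ ω in B, ‖(f * g) ω - a * b‖ ∂P
      ≤ ⨍ ω in B, (G * ‖f ω - a‖ + ‖a‖ * ‖g ω - b‖) ∂P := by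
        refine setAverage_mono_le (hfg.integrableOn.sub (integrable_const _)).norm
          (hi1.add hi2) (ae_restrict_of_ae ?_)
        filter_upwards [hG] with ω hω
        calc ‖(f * g) ω - a * b‖ = ‖g ω * (f ω - a) + a * (g ω - b)‖ := by
              rw [Pi.mul_apply]; ring_nf
          _ ≤ ‖g ω‖ * ‖f ω - a‖ + ‖a‖ * ‖g ω - b‖ := by
              rw [← norm_mul, ← norm_mul]; exact norm_add_le _ _
          _ ≤ _ := by gcongr
    _ = G * osc P B f + ‖a‖ * osc P B g := by
        rw [setAverage_eq, integral_add hi1 hi2, integral_const_mul, integral_const_mul, osc, osc,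
          setAverage_eq P (fun ω => ‖_‖), setAverage_eq P (fun ω => ‖_‖)]
        simp only [smul_eq_mul]
        ring

theorem bmoNorm_le {f : Ω → 𝕜} (hf : Integrable f P) {M M' : ℝ} (hM0 : 0 ≤ M)
    (hM : ∀ n B, IsPosAtom P (ℱ n) B → osc P B f ≤ M) (hM' : ‖∫ ω, f ω ∂P‖ ≤ M') :
    bmoNorm P ℱ f ≤ ENNReal.ofReal (M + M') := by
  rw [bmoNorm, campanatoNorm, ENNReal.ofReal_add hM0 ((norm_nonneg _).trans hM')]
  refine add_le_add ((campanatoSeminorm_le_iff (fun _ _ _ => one_pos) hf hM0).2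
    (by simpa using hM)) ?_
  rw [← ofReal_norm]
  exact ENNReal.ofReal_le_ofReal hM'

theorem osc_le_of_bmoNorm_le {f : Ω → 𝕜} (hf : Integrable f P) {K : ℝ} (hK : 0 ≤ K)
    (h : bmoNorm P ℱ f ≤ ENNReal.ofReal K) {n : ℕ} (hB : IsPosAtom P (ℱ n) B) :
    osc P B f ≤ K := by
  simpa using (campanatoSeminorm_le_iff (fun _ _ _ => one_pos) hf hK).1
    (le_self_add.trans h) n B hB

theorem mem_bmoN_of_osc_le {f : Ω → 𝕜} (hf : Integrable f P) {M : ℝ} (hM0 : 0 ≤ M)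
    (hM : ∀ n B, IsPosAtom P (ℱ n) B → osc P B f ≤ M) : f ∈ bmoN 𝕜 P ℱ :=
  ⟨hf, (bmoNorm_le hf hM0 hM le_rfl).trans_lt ENNReal.ofReal_lt_top⟩

theorem exists_osc_le_of_mem_bmoN {f : Ω → 𝕜} (hf : f ∈ bmoN 𝕜 P ℱ) :
    ∃ M, 0 ≤ M ∧ (∀ n B, IsPosAtom P (ℱ n) B → osc P B f ≤ M) ∧
      bmoNorm P ℱ f = ENNReal.ofReal (M + ‖∫ ω, f ω ∂P‖) := by
  have hlt : campanatoSeminorm P ℱ 1 (fun _ => 1) f < ∞ := le_self_add.trans_lt hf.2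
  refine ⟨(campanatoSeminorm P ℱ 1 (fun _ => 1) f).toReal, ENNReal.toReal_nonneg, ?_, ?_⟩
  · have := (campanatoSeminorm_le_iff (φ := fun _ => 1) (fun _ _ _ => one_pos) hf.1
      ENNReal.toReal_nonneg).1 (ENNReal.ofReal_toReal hlt.ne).ge
    simpa using this
  · rw [ENNReal.ofReal_add ENNReal.toReal_nonneg (norm_nonneg _), ENNReal.ofReal_toReal hlt.ne,
      ofReal_norm, bmoNorm, campanatoNorm]

/-- Triangle inequality around the mean. As `Ω` is an atom of `ℱ 0`, this lets the `BMO~` norm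
dominate the `L¹` norm. -/
theorem integral_norm_le {f : Ω → 𝕜} (hf : Integrable f P) :
    ∫ ω, ‖f ω‖ ∂P ≤ osc P Set.univ f + ‖∫ ω, f ω ∂P‖ := by
  have h : osc P Set.univ f = ∫ ω, ‖f ω - ∫ x, f x ∂P‖ ∂P := by
    simp [osc, average_eq_integral]
  have hi : Integrable (fun ω => ‖f ω - ∫ x, f x ∂P‖) P := (hf.sub (integrable_const _)).norm
  calc ∫ ω, ‖f ω‖ ∂P ≤ ∫ ω, (‖f ω - ∫ x, f x ∂P‖ + ‖∫ x, f x ∂P‖) ∂P :=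
        integral_mono hf.norm (hi.add (integrable_const _))
          fun ω => by simpa using norm_add_le (f ω - ∫ x, f x ∂P) (∫ x, f x ∂P)
    _ = _ := by rw [integral_add hi (integrable_const _), h]; simp

/-- Functions in `𝓛_{1,ψ} ∩ L_∞` multiply `BMO~` into itself. -/
theorem mul_mem_bmoN {R : ℝ} (hR2 : 2 ≤ R) (h0 : ℱ 0 = ⊥)
    (hgen : ∀ n, GeneratedByCountableAtoms P (ℱ n)) (hR : IsRegularWith P ℱ R) {f g : Ω → 𝕜}
    (hf : f ∈ bmoN 𝕜 P ℱ) (hg : g ∈ campanato 𝕜 P ℱ 1 psi) (hg' : g ∈ Linfty 𝕜 P) :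
    f * g ∈ bmoN 𝕜 P ℱ ∧ bmoNorm P ℱ (f * g) ≤
      ENNReal.ofReal (3 + 2 * (R / Real.log (R / (R - 1)))) *
        (campanatoSeminorm P ℱ 1 psi g + eLpNorm g ∞ P) * bmoNorm P ℱ f := by
  obtain ⟨M, hM0, hM, hN⟩ := exists_osc_le_of_mem_bmoN hf
  set M' := ‖∫ ω, f ω ∂P‖ with hM'
  have hM'0 : 0 ≤ M' := norm_nonneg _
  set S := (campanatoSeminorm P ℱ 1 psi g).toReal with hS
  set G := (eLpNorm g ∞ P).toReal with hG
  have hS0 : 0 ≤ S := ENNReal.toReal_nonneg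
  have hG0 : 0 ≤ G := ENNReal.toReal_nonneg
  have hSe : campanatoSeminorm P ℱ 1 psi g = ENNReal.ofReal S :=
    (ENNReal.ofReal_toReal hg.2.ne).symm
  have hGe : eLpNorm g ∞ P = ENNReal.ofReal G := (ENNReal.ofReal_toReal hg'.2.ne).symm
  have hGb : ∀ᵐ ω ∂P, ‖g ω‖ ≤ G := by
    rw [eLpNorm_exponent_top] at hGe
    filter_upwards [ae_le_eLpNormEssSup (f := g) (μ := P)] with ω hω
    rw [hGe, ← ofReal_norm, ENNReal.ofReal_le_ofReal_iff hG0] at hω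
    exact hω
  have hSb := (campanatoSeminorm_le_iff (fun _ => psi_pos) hg.1 hS0).1 hSe.le
  have hfg : Integrable (f * g) P := hf.1.mul_bdd hg.1.aestronglyMeasurable hGb
  set c := R / Real.log (R / (R - 1)) with hc
  have hc0 : 0 ≤ c := div_nonneg (by linarith)
    (Real.log_nonneg (by rw [le_div_iff₀ (by linarith)]; linarith))
  have hosc : ∀ n B, IsPosAtom P (ℱ n) B →
      osc P B (f * g) ≤ 2 * (G * M + (M' + c * M) * S) := by
    intro n B hB
    refine (osc_mul_le hB.2 hf.1 hg.1 hGb).trans (mul_le_mul_of_nonneg_left ?_ two_pos.le)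
    refine add_le_add (mul_le_mul_of_nonneg_left (hM n B hB) hG0) ?_
    have h1 := norm_setAverage_le_log hR2 h0 hgen hR hf.1 hM le_rfl hB
    have h2 := hSb n B hB
    rw [psi, log_exp_one_div hB.real_pos] at h2
    have hl := Real.log_nonpos hB.real_pos.le (measureReal_le_one (μ := P) (s := B))
    set l := -Real.log (P.real B) with hldef
    have hl' : 0 ≤ l := by linarith
    calc _ ≤ (M' + c * M * l) * (S * (1 / (1 - Real.log (P.real B)))) :=
          mul_le_mul h1 h2 (osc_nonneg g) (by positivity)
      _ = (M' + c * M * l) / (1 + l) * S := by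
          rw [hldef, ← sub_eq_add_neg]; ring
      -- The factor `1 + l` is `1 / psi (P B)`, and it dominates the growth of the average of `f`.
      _ ≤ (M' + c * M) * S := by
          refine mul_le_mul_of_nonneg_right ?_ hS0
          rw [div_le_iff₀ (by linarith)]
          have h3 : 0 ≤ c * M := by positivity
          nlinarith
  have hint : ‖∫ ω, (f * g) ω ∂P‖ ≤ G * (M + M') := by
    calc ‖∫ ω, (f * g) ω ∂P‖ ≤ ∫ ω, G * ‖f ω‖ ∂P := by
          refine norm_integral_le_of_norm_le (hf.1.norm.const_mul G) ?_
          filter_upwards [hGb] with ω hω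
          rw [Pi.mul_apply, norm_mul, mul_comm]
          gcongr
      _ = G * ∫ ω, ‖f ω‖ ∂P := integral_const_mul _ _
      _ ≤ G * (M + M') := mul_le_mul_of_nonneg_left ((integral_norm_le hf.1).trans
          (add_le_add_left (hM 0 _ (isPosAtom_univ h0)) _)) hG0
  have hpos : 0 ≤ 2 * (G * M + (M' + c * M) * S) := by positivity
  refine ⟨mem_bmoN_of_osc_le hfg hpos hosc, (bmoNorm_le hfg hpos hosc hint).trans ?_⟩
  rw [hN, hSe, hGe, ← ENNReal.ofReal_add hS0 hG0, ← ENNReal.ofReal_mul (by positivity),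
    ← ENNReal.ofReal_mul (by positivity)]
  -- In the constant `3 + 2 * c`, the oscillation accounts for `2 + 2 * c` and the mean for the
  -- remaining 1.
  refine ENNReal.ofReal_le_ofReal ?_
  have e1 : 0 ≤ G * M' := by positivity
  have e2 : 0 ≤ S * M := by positivity
  have e3 : 0 ≤ S * M' := by positivity
  have e4 : 0 ≤ c * (G * M) := by positivity
  have e5 : 0 ≤ c * (G * M') := by positivity
  have e6 : 0 ≤ c * (S * M') := by positivity
  linarith

/-! ### Necessity: indicators and the sup bound -/

/-- The point is uniformity in `B`: a function bounded by 1 has oscillation at most 2 and mean at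
most 1. -/
theorem bmoNorm_indicator_le (hB : MeasurableSet B) :
    B.indicator (fun _ => (1 : 𝕜)) ∈ bmoN 𝕜 P ℱ ∧
      bmoNorm P ℱ (B.indicator fun _ => (1 : 𝕜)) ≤ ENNReal.ofReal 3 := by
  have hi : Integrable (B.indicator fun _ => (1 : 𝕜)) P := (integrable_const _).indicator hB
  have hle : ∀ ω, ‖B.indicator (fun _ => (1 : 𝕜)) ω‖ ≤ 1 := fun ω => by
    by_cases h : ω ∈ B <;> simp [h]
  have h1 : ∀ n A, IsPosAtom P (ℱ n) A → osc P A (B.indicator fun _ => (1 : 𝕜)) ≤ 2 := by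
    intro n A hA
    refine (osc_le hA.2 hi.integrableOn 0).trans ?_
    have : ⨍ ω in A, ‖B.indicator (fun _ => (1 : 𝕜)) ω - 0‖ ∂P ≤ ⨍ _ in A, (1 : ℝ) ∂P := by
      simp only [sub_zero]
      exact setAverage_mono_le hi.integrableOn.norm (integrable_const _)
        (Filter.Eventually.of_forall hle)
    rw [setAverage_const hA.2 (measure_ne_top _ _)] at this
    linarith
  have h2 : ‖∫ ω, B.indicator (fun _ => (1 : 𝕜)) ω ∂P‖ ≤ 1 := by
    simpa using norm_integral_le_of_norm_le (integrable_const (1 : ℝ))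
      (Filter.Eventually.of_forall hle : ∀ᵐ ω ∂P, _)
  refine ⟨mem_bmoN_of_osc_le hi two_pos.le h1, (bmoNorm_le hi two_pos.le h1 h2).trans ?_⟩
  norm_num

/-- Let `A` be a parent of which `B` is a proper part. The product of `g` with the indicator of `B`
vanishes on `A \ B`, a fixed proportion of `A`, so bounded oscillation over `A` bounds its average
there. Passing from `A` to `B` costs one more factor `R`. If `A` and `B` agree a.e., the induction
moves up; at `Ω` the constant function 1 is the test. -/
theorem norm_setAverage_le_of_multiplier {R : ℝ} (hR2 : 2 ≤ R) (h0 : ℱ 0 = ⊥)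
    (hgen : ∀ n, GeneratedByCountableAtoms P (ℱ n)) (hR : IsRegularWith P ℱ R) {g : Ω → 𝕜}
    {K : ℝ} (hK : 0 ≤ K) (hg : ∀ f ∈ bmoN 𝕜 P ℱ, f * g ∈ bmoN 𝕜 P ℱ)
    (hgK : ∀ f ∈ bmoN 𝕜 P ℱ, bmoNorm P ℱ (f * g) ≤ ENNReal.ofReal K * bmoNorm P ℱ f)
    {n : ℕ} (hB : IsPosAtom P (ℱ n) B) : ‖⨍ ω in B, g ω ∂P‖ ≤ 3 * R ^ 2 * K := by
  have test : ∀ {B}, MeasurableSet B → Integrable (B.indicator (fun _ => (1 : 𝕜)) * g) P ∧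
      bmoNorm P ℱ (B.indicator (fun _ => (1 : 𝕜)) * g) ≤ ENNReal.ofReal (3 * K) := by
    intro B hB
    have h := bmoNorm_indicator_le (𝕜 := 𝕜) (P := P) (ℱ := ℱ) hB
    refine ⟨(hg _ h.1).1, (hgK _ h.1).trans ?_⟩
    rw [mul_comm 3 K, ENNReal.ofReal_mul hK]
    exact mul_le_mul_right h.2 _
  have h3K : 0 ≤ 3 * K := by positivity
  induction n generalizing B with
  | zero =>
    obtain rfl := hB.eq_univ h0
    have h1 := norm_integral_le_of_bmoNorm_le h3K (test MeasurableSet.univ).2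
    rw [← setIntegral_univ, setIntegral_indicator_mul MeasurableSet.univ (by simp)] at h1
    rw [setAverage_eq]
    simp only [probReal_univ, inv_one, one_smul]
    have hR1 : 1 ≤ R ^ 2 := one_le_pow₀ (by linarith)
    exact h1.trans (by nlinarith)
  | succ n ih =>
    obtain ⟨A, hA, hBA, h⟩ := hB.exists_parent_of_regular (hgen n) hR
    rcases h with h | ⟨h1, h2⟩
    · have := ih hA
      rwa [setAverage_congr h]
    have hBm := ℱ.le _ _ hB.measurableSet
    have hAm := ℱ.le _ _ hA.measurableSet
    have hpA := hA.real_pos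
    have hpB := hB.real_pos
    obtain ⟨hi, hN⟩ := test hBm
    set f := B.indicator (fun _ => (1 : 𝕜)) * g with hf
    have hosc := osc_le_of_bmoNorm_le hi h3K hN hA
    set c := ⨍ ω in A, f ω ∂P with hc
    have hic : IntegrableOn (fun ω => ‖f ω - c‖) A P :=
      (hi.integrableOn.sub (integrable_const c)).norm
    -- On `A \ B` the integrand `‖f - c‖` is the constant `‖c‖`.
    have h4 : P.real (A \ B) * ‖c‖ ≤ 3 * K * P.real A := by
      rw [osc, setAverage_eq, smul_eq_mul, inv_mul_le_iff₀ hpA] at hosc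
      calc P.real (A \ B) * ‖c‖ = ∫ ω in A \ B, ‖f ω - c‖ ∂P := by
            have : ∫ ω in A \ B, ‖f ω - c‖ ∂P = ∫ ω in A \ B, ‖c‖ ∂P := by
              refine setIntegral_congr_fun (hAm.diff hBm) fun ω hω => ?_
              simp [hf, hω.2]
            rw [this, setIntegral_const, smul_eq_mul]
        _ ≤ ∫ ω in A, ‖f ω - c‖ ∂P :=
            setIntegral_mono_set hic (Filter.Eventually.of_forall fun _ => norm_nonneg _)
              (LE.le.eventuallyLE Set.sdiff_subset)
        _ ≤ _ := by linarith
    have h5 : ‖c‖ ≤ 3 * K * R := by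
      have hpos : 0 < P.real (A \ B) := by
        by_contra hneg
        nlinarith
      refine le_of_mul_le_mul_left (h4.trans ?_) hpos
      calc 3 * K * P.real A ≤ 3 * K * (R * P.real (A \ B)) := mul_le_mul_of_nonneg_left h2 h3K
        _ = _ := by ring
    have h6 : ⨍ ω in B, g ω ∂P = ((P.real B)⁻¹ * P.real A) • c := by
      rw [hc, setAverage_eq P f, setIntegral_indicator_mul hBm hBA, smul_smul, mul_assoc,
        mul_inv_cancel₀ hpA.ne', mul_one, setAverage_eq]
    rw [h6, norm_smul, Real.norm_of_nonneg (by positivity)]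
    calc (P.real B)⁻¹ * P.real A * ‖c‖ ≤ R * (3 * K * R) := by
          refine mul_le_mul ?_ h5 (norm_nonneg _) (by linarith)
          rw [inv_mul_le_iff₀ hpB]
          linarith
      _ = _ := by ring

/-- An exceptional set of positive measure would meet some positive atom in positive measure, yet
there the conditional expectation is the average. -/
theorem ae_norm_condExp_le (hm : m ≤ mΩ) (hgen : GeneratedByCountableAtoms P m) {g : Ω → 𝕜}
    (hg : Integrable g P) {M : ℝ} (h : ∀ B, IsPosAtom P m B → ‖⨍ ω in B, g ω ∂P‖ ≤ M) :
    ∀ᵐ ω ∂P, ‖(P[g | m]) ω‖ ≤ M := by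
  rw [ae_iff]
  by_contra hne
  obtain ⟨B, hB, hAB⟩ := hgen.exists_isPosAtom hne
  have h1 := hB.condExp_ae_eq hm hg
  rw [Filter.EventuallyEq, ae_restrict_iff' (hm _ hB.measurableSet), ae_iff] at h1
  refine hAB (measure_mono_null ?_ h1)
  rintro ω ⟨hω, hωB⟩ hcon
  exact hω ((hcon hωB).symm ▸ h B hB)

/-- Lévy's upward theorem for the real and imaginary parts. Since the filtration generates `mΩ`, the
limit is `g` itself and not a projection of it. -/
theorem tendsto_condExp_ae (hsup : (⨆ n, ℱ n) = mΩ) {g : Ω → 𝕜} (hg : Integrable g P) :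
    ∀ᵐ ω ∂P, Filter.Tendsto (fun n => (P[g | ℱ n]) ω) Filter.atTop (nhds (g ω)) := by
  have real : ∀ u : Ω → ℝ, Integrable u P →
      ∀ᵐ ω ∂P, Filter.Tendsto (fun n => (P[u | ℱ n]) ω) Filter.atTop (nhds (u ω)) := by
    intro u hu
    have hms : StronglyMeasurable[⨆ n, ℱ n] (hu.1.mk u) := by
      rw [hsup]; exact hu.1.stronglyMeasurable_mk
    have h1 := (hu.congr hu.1.ae_eq_mk).tendsto_ae_condExp (ℱ := ℱ) hms
    have h2 : ∀ᵐ ω ∂P, ∀ n, (P[u | ℱ n]) ω = (P[hu.1.mk u | ℱ n]) ω :=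
      ae_all_iff.2 fun n => condExp_congr_ae hu.1.ae_eq_mk
    filter_upwards [h1, h2, hu.1.ae_eq_mk] with ω h1 h2 h3
    simpa only [h2, h3] using h1
  have hre := ae_all_iff.2 fun n => RCLike.reCLM.comp_condExp_comm (m := ℱ n) hg
  have him := ae_all_iff.2 fun n => RCLike.imCLM.comp_condExp_comm (m := ℱ n) hg
  filter_upwards [real _ hg.re, real _ hg.im, hre, him] with ω h1 h2 h3 h4
  have h5 : Filter.Tendsto (fun n => RCLike.re ((P[g | ℱ n]) ω)) Filter.atTop
      (nhds (RCLike.re (g ω))) := by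
    refine h1.congr fun n => ?_
    exact (h3 n).symm
  have h6 : Filter.Tendsto (fun n => RCLike.im ((P[g | ℱ n]) ω)) Filter.atTop
      (nhds (RCLike.im (g ω))) := by
    refine h2.congr fun n => ?_
    exact (h4 n).symm
  have h7 := ((RCLike.continuous_ofReal (K := 𝕜)).tendsto _).comp h5 |>.add
    ((((RCLike.continuous_ofReal (K := 𝕜)).tendsto _).comp h6).mul_const (RCLike.I : 𝕜))
  simpa only [Function.comp_def, RCLike.re_add_im] using h7

/-! ### Necessity: logarithmic test functions and the `psi` bound -/

/-- For an atom `B`, a nonnegative function which is `log (e / P B)` on `B` and whose mean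
oscillation is bounded by an absolute constant. -/
theorem exists_log_function (h0 : ℱ 0 = ⊥) (hgen : ∀ n, GeneratedByCountableAtoms P (ℱ n))
    {n : ℕ} (hB : IsPosAtom P (ℱ n) B) :
    ∃ F : Ω → ℝ, Measurable[ℱ n] F ∧ Integrable F P ∧
      (∀ᵐ ω ∂P.restrict B, F ω = 1 - Real.log (P.real B)) ∧ (∀ ω, 0 ≤ F ω) ∧
      ∫ ω, F ω ∂P + P.real B ≤ 2 ∧
      ∀ m A, IsPosAtom P (ℱ m) A → ∃ c, (∀ᵐ ω ∂P.restrict A, c ≤ F ω) ∧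
        ∫ ω in A, F ω ∂P - c * P.real A + P.real (A ∩ B) ≤ P.real A := by
  -- `F` is 1 plus the increments `log (P D / P B)` on `B`, summed along the chain of parents. The
  -- terms `P B` and `P (A ∩ B)` in the bounds are a reserve from which the next increment is paid.
  -- Bounding `F` below by `c` on `A` turns the mean distance to `c` into a plain integral.
  induction n generalizing B with
  | zero =>
    obtain rfl := hB.eq_univ h0
    refine ⟨fun _ => 1, measurable_const, integrable_const _, ?_, fun _ => zero_le_one, ?_, ?_⟩
    · simp
    · simp; norm_num
    · exact fun m A _ => ⟨1, by simp, by simp⟩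
  | succ n ih =>
    obtain ⟨D, hD, hBD⟩ := hB.exists_parent (ℱ.mono (Nat.le_succ n)) (ℱ.le _) (hgen n)
    obtain ⟨F, hFm, hFi, hFD, hF0, hFint, hF⟩ := ih hD
    have hBm := ℱ.le _ _ hB.measurableSet
    have hpD := hD.real_pos
    have hpB := hB.real_pos
    have hBleD : P.real B ≤ P.real D := by
      linarith [measureReal_add_diff_of_null hBm hBD, measureReal_nonneg (μ := P) (s := D \ B)]
    set t := Real.log (P.real D) - Real.log (P.real B) with ht
    have ht0 : 0 ≤ t := sub_nonneg.2 (Real.log_le_log hpB hBleD)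
    -- By `log x ≤ x - 1`, the integral `t * P B` of the increment is at most the drop of the
    -- reserve from `P D` to `P B`.
    have htB : t * P.real B + P.real B ≤ P.real D := by
      have h1 : t ≤ P.real D / P.real B - 1 := by
        rw [ht, ← Real.log_div hpD.ne' hpB.ne']
        exact Real.log_le_sub_one_of_pos (div_pos hpD hpB)
      have h2 := mul_le_mul_of_nonneg_right h1 hpB.le
      rw [sub_mul (P.real D / P.real B), div_mul_cancel₀ _ hpB.ne'] at h2
      linarith
    have hi : Integrable (B.indicator fun _ => t) P := (integrable_const t).indicator hBm
    have hF'm : Measurable[ℱ (n + 1)] (fun ω => F ω + B.indicator (fun _ => t) ω) :=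
      (hFm.mono (ℱ.mono (Nat.le_succ n)) le_rfl).add (measurable_const.indicator hB.measurableSet)
    have hset : ∀ A, ∫ ω in A, (F ω + B.indicator (fun _ => t) ω) ∂P =
        ∫ ω in A, F ω ∂P + t * P.real (A ∩ B) := by
      intro A
      rw [integral_add hFi.integrableOn hi.integrableOn, setIntegral_indicator hBm,
        setIntegral_const, smul_eq_mul, mul_comm t]
    refine ⟨fun ω => F ω + B.indicator (fun _ => t) ω, hF'm, hFi.add hi, ?_, ?_, ?_, ?_⟩
    · have h1 : ∀ᵐ ω ∂P.restrict B, F ω = 1 - Real.log (P.real D) :=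
        ae_mono (Measure.restrict_mono' (ae_le_set.2 hBD) le_rfl) hFD
      filter_upwards [h1, ae_restrict_mem hBm] with ω h1 h2
      rw [h1, Set.indicator_of_mem h2, ht]
      ring
    · exact fun ω => add_nonneg (hF0 ω) (Set.indicator_nonneg (fun _ _ => ht0) ω)
    · rw [← setIntegral_univ, hset, Set.univ_inter, setIntegral_univ]
      linarith
    · intro k A hA
      have hAm := ℱ.le _ _ hA.measurableSet
      rcases le_or_gt k n with hk | hk
      · obtain ⟨c, hc, hcA⟩ := hF k A hA
        refine ⟨c, ?_, ?_⟩
        · filter_upwards [hc] with ω hω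
          exact hω.trans (le_add_of_nonneg_right (Set.indicator_nonneg (fun _ _ => ht0) ω))
        · rw [hset]
          -- An atom of a level `k ≤ n` contains `D` up to a null set or misses it; in the first
          -- case `htB` applies, in the second nothing is added on `A`.
          have key : t * P.real (A ∩ B) + P.real (A ∩ B) ≤ P.real (A ∩ D) := by
            rcases hD.diff_null_or_inter_null (ℱ.le n) (ℱ.mono hk _ hA.measurableSet) with h | h
            · have h1 : P.real (A ∩ D) = P.real D := by
                have := measureReal_inter_add_sdiff (μ := P) (s := D) hAm
                rw [measureReal_def P (D \ A), h, ENNReal.toReal_zero, add_zero] at this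
                rw [Set.inter_comm, this]
              have h2 : P.real (A ∩ B) ≤ P.real B := measureReal_mono Set.inter_subset_right
              have h3 := mul_le_mul_of_nonneg_left h2 ht0
              linarith
            · have h1 : P (A ∩ B) = 0 := by
                refine measure_mono_null (t := (D ∩ A) ∪ (B \ D)) ?_ (measure_union_null h hBD)
                rintro ω ⟨h1, h2⟩
                by_cases h3 : ω ∈ D
                · exact Or.inl ⟨h3, h1⟩
                · exact Or.inr ⟨h2, h3⟩
              rw [measureReal_def P (A ∩ B), h1]
              simp
          linarith
      -- From level `n + 1` on, the new function is a.e. constant on atoms.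
      · obtain ⟨c, hc⟩ := hA.ae_eq_const (ℱ.le k) (hF'm.mono (ℱ.mono hk) le_rfl)
        refine ⟨c, hc.mono fun ω hω => hω.ge, ?_⟩
        rw [integral_congr_ae hc, setIntegral_const, smul_eq_mul, mul_comm, sub_self, zero_add]
        exact measureReal_mono Set.inter_subset_left

/-- The test function has oscillations and mean at most 2, hence norm at most 4. On `B` it is the
scalar `1 - log (P B)`, the reciprocal of `psi (P B)`, which factors out of the oscillation of the
product. -/
theorem osc_le_mul_psi_of_multiplier (h0 : ℱ 0 = ⊥)
    (hgen : ∀ n, GeneratedByCountableAtoms P (ℱ n)) {g : Ω → 𝕜}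
    {K : ℝ} (hK : 0 ≤ K) (hg : ∀ f ∈ bmoN 𝕜 P ℱ, f * g ∈ bmoN 𝕜 P ℱ)
    (hgK : ∀ f ∈ bmoN 𝕜 P ℱ, bmoNorm P ℱ (f * g) ≤ ENNReal.ofReal K * bmoNorm P ℱ f)
    {n : ℕ} (hB : IsPosAtom P (ℱ n) B) : osc P B g ≤ 4 * K * psi (P.real B) := by
  obtain ⟨F, -, hFi, hFB, hF0, hFint, hF⟩ := exists_log_function h0 hgen hB
  set f : Ω → 𝕜 := fun ω => (F ω : 𝕜) with hf
  have hfi : Integrable f P := hFi.ofReal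
  have hosc : ∀ m A, IsPosAtom P (ℱ m) A → osc P A f ≤ 2 := by
    intro m A hA
    obtain ⟨c, hc, hcA⟩ := hF m A hA
    refine (osc_le hA.2 hfi.integrableOn (c : 𝕜)).trans ?_
    have h1 : ∫ ω in A, ‖f ω - c‖ ∂P = ∫ ω in A, F ω ∂P - c * P.real A := by
      have h2 : ∫ ω in A, ‖f ω - c‖ ∂P = ∫ ω in A, (F ω - c) ∂P := by
        refine integral_congr_ae ?_
        filter_upwards [hc] with ω hω
        rw [hf, ← RCLike.ofReal_sub, RCLike.norm_ofReal, abs_of_nonneg (sub_nonneg.2 hω)]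
      rw [h2, integral_sub hFi.integrableOn (integrable_const c), setIntegral_const, smul_eq_mul,
        mul_comm c]
    have h3 : ⨍ ω in A, ‖f ω - c‖ ∂P ≤ 1 := by
      rw [setAverage_eq, smul_eq_mul, inv_mul_le_iff₀ hA.real_pos, h1]
      linarith [measureReal_nonneg (μ := P) (s := A ∩ B)]
    linarith
  have hint : ‖∫ ω, f ω ∂P‖ ≤ 2 := by
    rw [hf, integral_ofReal, RCLike.norm_ofReal, abs_of_nonneg (integral_nonneg hF0)]
    linarith [hB.real_pos]
  have hmem := mem_bmoN_of_osc_le hfi two_pos.le hosc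
  have hfN : bmoNorm P ℱ f ≤ ENNReal.ofReal 4 :=
    (bmoNorm_le hfi two_pos.le hosc hint).trans (by norm_num)
  have hfgN : bmoNorm P ℱ (f * g) ≤ ENNReal.ofReal (4 * K) := by
    refine (hgK f hmem).trans ?_
    rw [mul_comm 4 K, ENNReal.ofReal_mul hK]
    exact mul_le_mul_right hfN _
  have h1 := osc_le_of_bmoNorm_le (hg f hmem).1 (by positivity) hfgN hB
  have h2 : f * g =ᵐ[P.restrict B] fun ω => ((1 - Real.log (P.real B) : ℝ) : 𝕜) * g ω := by
    filter_upwards [hFB] with ω hω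
    rw [Pi.mul_apply, hf]
    simp only [hω]
  have hl := Real.log_nonpos hB.real_pos.le (measureReal_le_one (μ := P) (s := B))
  rw [osc_congr h2, osc_const_mul, RCLike.norm_ofReal, abs_of_nonneg (by linarith)] at h1
  rw [psi, log_exp_one_div hB.real_pos, mul_one_div, le_div_iff₀ (by linarith)]
  linarith

theorem one_mem_bmoN : (fun _ => 1) ∈ bmoN 𝕜 P ℱ := by
  simpa using (bmoNorm_indicator_le (𝕜 := 𝕜) (P := P) (ℱ := ℱ) MeasurableSet.univ).1

/-- A bounded multiplier of `BMO~` belongs to `𝓛_{1,ψ} ∩ L_∞`. -/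
theorem mem_campanato_inter_Linfty_of_multiplier {R : ℝ} (hR2 : 2 ≤ R)
    (hsup : (⨆ n, ℱ n) = mΩ) (h0 : ℱ 0 = ⊥)
    (hgen : ∀ n, GeneratedByCountableAtoms P (ℱ n)) (hR : IsRegularWith P ℱ R) {g : Ω → 𝕜}
    {K : ℝ} (hK : 0 ≤ K) (hg : ∀ f ∈ bmoN 𝕜 P ℱ, f * g ∈ bmoN 𝕜 P ℱ)
    (hgK : ∀ f ∈ bmoN 𝕜 P ℱ, bmoNorm P ℱ (f * g) ≤ ENNReal.ofReal K * bmoNorm P ℱ f) :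
    g ∈ campanato 𝕜 P ℱ 1 psi ∩ Linfty 𝕜 P ∧
      campanatoSeminorm P ℱ 1 psi g + eLpNorm g ∞ P ≤
        ENNReal.ofReal (4 + 3 * R ^ 2) * ENNReal.ofReal K := by
  have hgi : Integrable g P := by
    have := (hg _ one_mem_bmoN).1
    have h1 : (fun _ => (1 : 𝕜)) * g = g := one_mul g
    rwa [h1] at this
  have hsemi : campanatoSeminorm P ℱ 1 psi g ≤ ENNReal.ofReal (4 * K) :=
    (campanatoSeminorm_le_iff (fun _ => psi_pos) hgi (by positivity)).2
      fun n B hB => osc_le_mul_psi_of_multiplier h0 hgen hK hg hgK hB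
  have hbdd : ∀ᵐ ω ∂P, ‖g ω‖ ≤ 3 * R ^ 2 * K := by
    have h1 : ∀ᵐ ω ∂P, ∀ n, ‖(P[g | ℱ n]) ω‖ ≤ 3 * R ^ 2 * K :=
      ae_all_iff.2 fun n => ae_norm_condExp_le (ℱ.le n) (hgen n) hgi
        fun B hB => norm_setAverage_le_of_multiplier hR2 h0 hgen hR hK hg hgK hB
    filter_upwards [h1, tendsto_condExp_ae hsup hgi] with ω h1 h2
    exact le_of_tendsto h2.norm (Filter.Eventually.of_forall h1)
  have hinf : eLpNorm g ∞ P ≤ ENNReal.ofReal (3 * R ^ 2 * K) := by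
    rw [eLpNorm_exponent_top]
    exact eLpNormEssSup_le_of_ae_bound hbdd
  refine ⟨⟨⟨hgi, hsemi.trans_lt ENNReal.ofReal_lt_top⟩, hgi.1,
    hinf.trans_lt ENNReal.ofReal_lt_top⟩, (add_le_add hsemi hinf).trans ?_⟩
  rw [← ENNReal.ofReal_add (by positivity) (by positivity), ← ENNReal.ofReal_mul (by positivity)]
  exact ENNReal.ofReal_le_ofReal (by linarith)

/-! ### Automatic boundedness of multipliers -/

/-- The operator `f ↦ (P B)⁻¹ (f - E[f | m])` from `L¹(P)` to `L¹(P|_B)`. -/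
noncomputable def oscCLM (𝕜 : Type*) [RCLike 𝕜] (P : Measure Ω) [IsProbabilityMeasure P]
    (hm : m ≤ mΩ) (B : Set Ω) : Lp 𝕜 1 P →L[ℝ] Lp 𝕜 1 (P.restrict B) :=
  (P.real B)⁻¹ • (LpToLpRestrictCLM Ω 𝕜 ℝ P 1 B).comp
    (ContinuousLinearMap.id ℝ (Lp 𝕜 1 P) - condExpL1CLM 𝕜 hm P)

theorem norm_oscCLM (hm : m ≤ mΩ) (hB : IsPosAtom P m B) (x : Lp 𝕜 1 P) :
    ‖oscCLM 𝕜 P hm B x‖ = osc P B x := by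
  have hx : Integrable x P := L1.integrable_coeFn x
  have h1 : oscCLM 𝕜 P hm B x =
      (P.real B)⁻¹ • LpToLpRestrictCLM Ω 𝕜 ℝ P 1 B (x - condExpL1CLM 𝕜 hm P x) := rfl
  rw [h1, norm_smul, Real.norm_of_nonneg (by positivity), L1.norm_eq_integral_norm, osc,
    setAverage_eq P (fun ω => ‖_‖), smul_eq_mul]
  congr 1
  refine integral_congr_ae ?_
  have h2 : P[x | m] =ᵐ[P] condExpL1CLM 𝕜 hm P x := by
    have := condExp_ae_eq_condExpL1 hm (μ := P) x
    rwa [condExpL1_eq hx, Integrable.toL1_coeFn] at this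
  filter_upwards [LpToLpRestrictCLM_coeFn ℝ B (x - condExpL1CLM 𝕜 hm P x),
    ae_restrict_of_ae (Lp.coeFn_sub x (condExpL1CLM 𝕜 hm P x)), ae_restrict_of_ae h2,
    hB.condExp_ae_eq hm hx] with ω h3 h4 h5 h6
  rw [h3, h4, Pi.sub_apply, ← h5, h6]

/-- The operators whose norms are the mean oscillations over atoms. -/
noncomputable def oscFamily (𝕜 : Type*) [RCLike 𝕜] (P : Measure Ω) [IsProbabilityMeasure P]
    (ℱ : Filtration ℕ mΩ) (i : {p : ℕ × Set Ω // IsPosAtom P (ℱ p.1) p.2}) :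
    Lp 𝕜 1 P →L[ℝ] Lp 𝕜 1 (P.restrict i.1.2) :=
  oscCLM 𝕜 P (ℱ.le i.1.1) i.1.2

theorem mem_bmoN_congr {f g : Ω → 𝕜} (h : f =ᵐ[P] g) (hf : f ∈ bmoN 𝕜 P ℱ) :
    g ∈ bmoN 𝕜 P ℱ := by
  obtain ⟨M, hM0, hM, -⟩ := exists_osc_le_of_mem_bmoN hf
  exact mem_bmoN_of_osc_le (hf.1.congr h) hM0
    fun n B hB => (osc_congr (ae_restrict_of_ae h)).ge.trans (hM n B hB)

/-- Identifies `BMO~`, modulo a.e. equality, with the space to which the abstract closed graph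
theorem applies. -/
theorem mem_pointwiseBounded_iff (h0 : ℱ 0 = ⊥) (x : Lp 𝕜 1 P) :
    x ∈ pointwiseBounded (oscFamily 𝕜 P ℱ) ↔ (x : Ω → 𝕜) ∈ bmoN 𝕜 P ℱ := by
  constructor
  · rintro ⟨M, hM⟩
    have h : ∀ n B, IsPosAtom P (ℱ n) B → osc P B (x : Ω → 𝕜) ≤ M := fun n B hB => by
      rw [← norm_oscCLM (ℱ.le n) hB]
      exact hM ⟨⟨(n, B), hB⟩, rfl⟩
    exact mem_bmoN_of_osc_le (L1.integrable_coeFn x)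
      ((osc_nonneg _).trans (h 0 _ (isPosAtom_univ h0))) h
  · intro hx
    obtain ⟨M, -, hM, -⟩ := exists_osc_le_of_mem_bmoN hx
    refine ⟨M, ?_⟩
    rintro _ ⟨⟨⟨n, B⟩, hB⟩, rfl⟩
    exact (norm_oscCLM (ℱ.le n) hB x).le.trans (hM n B hB)

theorem integrable_mul_of_multiplier {g : Ω → 𝕜} (h0 : ℱ 0 = ⊥)
    (hg : ∀ f ∈ bmoN 𝕜 P ℱ, f * g ∈ bmoN 𝕜 P ℱ) (x : pointwiseBounded (oscFamily 𝕜 P ℱ)) :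
    Integrable (((x : Lp 𝕜 1 P) : Ω → 𝕜) * g) P :=
  (hg _ ((mem_pointwiseBounded_iff h0 _).1 x.2)).1

/-- The product with a pointwise multiplier of `BMO~`, as an element of `L¹`. -/
noncomputable def mulL1 {g : Ω → 𝕜} (h0 : ℱ 0 = ⊥)
    (hg : ∀ f ∈ bmoN 𝕜 P ℱ, f * g ∈ bmoN 𝕜 P ℱ) (x : pointwiseBounded (oscFamily 𝕜 P ℱ)) :
    Lp 𝕜 1 P :=
  (integrable_mul_of_multiplier h0 hg x).toL1 _

theorem mulL1_coeFn {g : Ω → 𝕜} (h0 : ℱ 0 = ⊥)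
    (hg : ∀ f ∈ bmoN 𝕜 P ℱ, f * g ∈ bmoN 𝕜 P ℱ) (x : pointwiseBounded (oscFamily 𝕜 P ℱ)) :
    mulL1 h0 hg x =ᵐ[P] (x : Lp 𝕜 1 P) * g :=
  (integrable_mul_of_multiplier h0 hg x).coeFn_toL1

theorem mulL1_mem {g : Ω → 𝕜} (h0 : ℱ 0 = ⊥)
    (hg : ∀ f ∈ bmoN 𝕜 P ℱ, f * g ∈ bmoN 𝕜 P ℱ) (x : pointwiseBounded (oscFamily 𝕜 P ℱ)) :
    mulL1 h0 hg x ∈ pointwiseBounded (oscFamily 𝕜 P ℱ) :=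
  (mem_pointwiseBounded_iff h0 _).2 (mem_bmoN_congr (mulL1_coeFn h0 hg x).symm
    (hg _ ((mem_pointwiseBounded_iff h0 _).1 x.2)))

/-- Multiplication by a pointwise multiplier of `BMO~`, as a linear map. -/
noncomputable def mulLinearMap {g : Ω → 𝕜} (h0 : ℱ 0 = ⊥)
    (hg : ∀ f ∈ bmoN 𝕜 P ℱ, f * g ∈ bmoN 𝕜 P ℱ) :
    pointwiseBounded (oscFamily 𝕜 P ℱ) →ₗ[ℝ] pointwiseBounded (oscFamily 𝕜 P ℱ) where
  toFun x := ⟨mulL1 h0 hg x, mulL1_mem h0 hg x⟩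
  map_add' x y := by
    refine Subtype.ext ?_
    change mulL1 h0 hg (x + y) = mulL1 h0 hg x + mulL1 h0 hg y
    refine Lp.ext ?_
    filter_upwards [mulL1_coeFn h0 hg (x + y), mulL1_coeFn h0 hg x, mulL1_coeFn h0 hg y,
      Lp.coeFn_add (x : Lp 𝕜 1 P) y, Lp.coeFn_add (mulL1 h0 hg x) (mulL1 h0 hg y)]
      with ω h1 h2 h3 h4 h5
    rw [h1, h5, Pi.add_apply, h2, h3, Submodule.coe_add]
    simp only [Pi.mul_apply, h4, Pi.add_apply, add_mul]
  map_smul' c x := by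
    refine Subtype.ext ?_
    change mulL1 h0 hg (c • x) = c • mulL1 h0 hg x
    refine Lp.ext ?_
    filter_upwards [mulL1_coeFn h0 hg (c • x), mulL1_coeFn h0 hg x,
      Lp.coeFn_smul c (x : Lp 𝕜 1 P), Lp.coeFn_smul c (mulL1 h0 hg x)] with ω h1 h2 h3 h4
    rw [h1, h4, Pi.smul_apply, h2, Submodule.coe_smul]
    simp only [Pi.mul_apply, h3, Pi.smul_apply, smul_mul_assoc]

theorem mulLinearMap_coeFn {g : Ω → 𝕜} (h0 : ℱ 0 = ⊥)
    (hg : ∀ f ∈ bmoN 𝕜 P ℱ, f * g ∈ bmoN 𝕜 P ℱ) (x : pointwiseBounded (oscFamily 𝕜 P ℱ)) :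
    ((mulLinearMap h0 hg x : Lp 𝕜 1 P) : Ω → 𝕜) =ᵐ[P] (x : Lp 𝕜 1 P) * g :=
  mulL1_coeFn h0 hg x

/-- Convergence in `L¹` gives a.e. convergence along a subsequence, and multiplication by a fixed
function preserves a.e. limits. A second extraction handles the products. -/
theorem mulLinearMap_closed_graph {g : Ω → 𝕜} (h0 : ℱ 0 = ⊥)
    (hg : ∀ f ∈ bmoN 𝕜 P ℱ, f * g ∈ bmoN 𝕜 P ℱ)
    (u : ℕ → pointwiseBounded (oscFamily 𝕜 P ℱ)) (x y : pointwiseBounded (oscFamily 𝕜 P ℱ))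
    (hu : Filter.Tendsto (fun n => (u n : Lp 𝕜 1 P)) Filter.atTop (nhds x))
    (hy : Filter.Tendsto (fun n => (mulLinearMap h0 hg (u n) : Lp 𝕜 1 P)) Filter.atTop (nhds y)) :
    (y : Lp 𝕜 1 P) = mulLinearMap h0 hg x := by
  obtain ⟨ns, hns, h1⟩ := (tendstoInMeasure_of_tendsto_Lp hu).exists_seq_tendsto_ae
  obtain ⟨ms, hms, h2⟩ := (tendstoInMeasure_of_tendsto_Lp
    (hy.comp hns.tendsto_atTop)).exists_seq_tendsto_ae
  refine Lp.ext ?_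
  filter_upwards [h1, h2, ae_all_iff.2 fun n => mulLinearMap_coeFn h0 hg (u n),
    mulLinearMap_coeFn h0 hg x] with ω h1 h2 h3 h4
  rw [h4]
  refine tendsto_nhds_unique h2 ?_
  simp only [Function.comp_apply, h3, Pi.mul_apply]
  exact (h1.comp hms.tendsto_atTop).mul_const _

/-- Every pointwise multiplier of `BMO~` is a bounded operator. -/
theorem exists_bmoNorm_mul_le {g : Ω → 𝕜} (h0 : ℱ 0 = ⊥)
    (hg : ∀ f ∈ bmoN 𝕜 P ℱ, f * g ∈ bmoN 𝕜 P ℱ) :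
    ∃ K : ℝ, 0 ≤ K ∧
      ∀ f ∈ bmoN 𝕜 P ℱ, bmoNorm P ℱ (f * g) ≤ ENNReal.ofReal K * bmoNorm P ℱ f := by
  obtain ⟨K, hK, h⟩ := exists_bound_of_closed_graph _ (mulLinearMap h0 hg)
    (mulLinearMap_closed_graph h0 hg)
  -- One `K` bounds the oscillations of the product and the other its mean, the latter through the
  -- `L¹` norm.
  refine ⟨2 * K, by positivity, fun f hf => ?_⟩
  obtain ⟨M, hM0, hM, hN⟩ := exists_osc_le_of_mem_bmoN hf
  have hfi : Integrable f P := hf.1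
  have hx : hfi.toL1 f ∈ pointwiseBounded (oscFamily 𝕜 P ℱ) :=
    (mem_pointwiseBounded_iff h0 _).2 (mem_bmoN_congr (Integrable.coeFn_toL1 _).symm hf)
  set M₁ := M + ‖∫ ω, f ω ∂P‖ with hM₁
  have hMM₁ : M ≤ M₁ := le_add_of_nonneg_right (norm_nonneg _)
  have hM₁0 : 0 ≤ M₁ := hM0.trans hMM₁
  have hfae : ((hfi.toL1 f : Lp 𝕜 1 P) : Ω → 𝕜) =ᵐ[P] f := Integrable.coeFn_toL1 _
  have hSae : ((mulLinearMap h0 hg ⟨_, hx⟩ : Lp 𝕜 1 P) : Ω → 𝕜) =ᵐ[P] f * g :=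
    (mulLinearMap_coeFn h0 hg ⟨_, hx⟩).trans (hfae.mul Filter.EventuallyEq.rfl)
  obtain ⟨h1, h2⟩ := h ⟨_, hx⟩ M₁ hM₁0
    (by
      refine ((L1.norm_eq_integral_norm _).trans
        (integral_congr_ae (hfae.fun_comp norm))).le.trans ?_
      exact (integral_norm_le hf.1).trans
        (add_le_add_left (hM 0 _ (isPosAtom_univ h0)) _))
    (by
      rintro ⟨⟨n, B⟩, hB⟩
      refine (norm_oscCLM (ℱ.le n) hB _).le.trans ?_
      rw [osc_congr (ae_restrict_of_ae hfae)]
      exact (hM n B hB).trans hMM₁)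
  have hosc : ∀ n B, IsPosAtom P (ℱ n) B → osc P B (f * g) ≤ K * M₁ := fun n B hB => by
    rw [← osc_congr (ae_restrict_of_ae hSae), ← norm_oscCLM (ℱ.le n) hB]
    exact h2 ⟨(n, B), hB⟩
  have hint : ‖∫ ω, (f * g) ω ∂P‖ ≤ K * M₁ := by
    refine (norm_integral_le_integral_norm _).trans ?_
    exact ((L1.norm_eq_integral_norm _).trans
      (integral_congr_ae (hSae.fun_comp norm))).ge.trans h1
  refine (bmoNorm_le (hg f hf).1 (by positivity) hosc hint).trans ?_
  rw [hN, ← ENNReal.ofReal_mul (by positivity)]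
  exact ENNReal.ofReal_le_ofReal (by linarith)

/-! ### The operator norm and the final statement -/

theorem bmoNorm_ne_zero (h0 : ℱ 0 = ⊥) {f : Ω → 𝕜} (hf : Integrable f P)
    (hne : ¬ f =ᵐ[P] 0) : bmoNorm P ℱ f ≠ 0 := by
  intro h
  have h1 : bmoNorm P ℱ f ≤ ENNReal.ofReal 0 := by simp [h]
  have h2 := integral_norm_le hf
  have h3 := osc_le_of_bmoNorm_le hf le_rfl h1 (isPosAtom_univ h0)
  have h4 := norm_integral_le_of_bmoNorm_le le_rfl h1
  have h5 : ∫ ω, ‖f ω‖ ∂P = 0 :=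
    le_antisymm (by linarith) (integral_nonneg fun _ => norm_nonneg _)
  rw [integral_eq_zero_iff_of_nonneg (fun _ => norm_nonneg _) hf.norm] at h5
  exact hne (h5.mono fun ω hω => norm_eq_zero.1 hω)

/-- The supremum omits functions that vanish a.e.; for these the product vanishes a.e. too. For all
others the norm is nonzero and finite, so the division can be undone. -/
theorem bmoNorm_mul_le_opNorm_mul (h0 : ℱ 0 = ⊥) {f : Ω → 𝕜} (hf : f ∈ bmoN 𝕜 P ℱ)
    (g : Ω → 𝕜) :
    bmoNorm P ℱ (f * g) ≤ opNorm P (bmoN 𝕜 P ℱ) (bmoNorm P ℱ) g * bmoNorm P ℱ f := by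
  by_cases hne : f =ᵐ[P] 0
  · have h1 : f * g =ᵐ[P] fun _ => 0 := by
      filter_upwards [hne] with ω hω
      simp [hω]
    have h2 : bmoNorm P ℱ (f * g) ≤ ENNReal.ofReal (0 + 0) := by
      refine bmoNorm_le ((integrable_zero _ _ _).congr h1.symm) le_rfl (fun n B hB => ?_) ?_
      · rw [osc_congr (ae_restrict_of_ae h1)]
        simp [osc]
      · rw [integral_congr_ae h1]
        simp
    refine h2.trans ?_
    simp
  · rw [← ENNReal.div_le_iff (bmoNorm_ne_zero h0 hf.1 hne) hf.2.ne]
    exact le_iSup₂_of_le f hf (le_iSup_of_le hne le_rfl)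

end

end MartingaleCampanato

theorem corollary1p2 (𝕜 : Type*) [RCLike 𝕜] (R : ℝ) (hR : 2 ≤ R) :
    ∃ C : ℝ≥0, 0 < C ∧
      ∀ (Ω : Type*) [mΩ : MeasurableSpace Ω] (P : Measure Ω) [IsProbabilityMeasure P]
        (ℱ : Filtration ℕ mΩ),
        (⨆ n, ℱ n) = mΩ →
        (∀ n, MartingaleCampanato.GeneratedByCountableAtoms P (ℱ n)) →
        ℱ 0 = ⊥ →
        MartingaleCampanato.IsRegularWith P ℱ R →
        MartingaleCampanato.pwm P (MartingaleCampanato.bmoN 𝕜 P ℱ) =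
            MartingaleCampanato.campanato 𝕜 P ℱ 1 MartingaleCampanato.psi ∩
              MartingaleCampanato.Linfty 𝕜 P ∧
          ∀ g ∈ MartingaleCampanato.pwm P (MartingaleCampanato.bmoN 𝕜 P ℱ),
            MartingaleCampanato.opNorm P (MartingaleCampanato.bmoN 𝕜 P ℱ)
                (MartingaleCampanato.bmoNorm P ℱ) g ≤
              C * (MartingaleCampanato.campanatoSeminorm P ℱ 1 MartingaleCampanato.psi g +
                eLpNorm g ∞ P) ∧
            MartingaleCampanato.campanatoSeminorm P ℱ 1 MartingaleCampanato.psi g +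
                eLpNorm g ∞ P ≤
              C * MartingaleCampanato.opNorm P (MartingaleCampanato.bmoN 𝕜 P ℱ)
                (MartingaleCampanato.bmoNorm P ℱ) g := by
  have hlog : 0 ≤ R / Real.log (R / (R - 1)) := div_nonneg (by linarith)
    (Real.log_nonneg (by rw [le_div_iff₀ (by linarith)]; linarith))
  set c₁ := 3 + 2 * (R / Real.log (R / (R - 1))) with hc₁
  set c₂ := 4 + 3 * R ^ 2 with hc₂
  have hc₁0 : 0 < c₁ := by positivity
  have hc₂0 : 0 < c₂ := by positivity
  have hpos : 0 < Real.toNNReal (c₁ + c₂) := Real.toNNReal_pos.2 (by positivity)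
  refine ⟨Real.toNNReal (c₁ + c₂), hpos, ?_⟩
  intro Ω mΩ P _ ℱ hsup hgen h0 hreg
  have hle₁ : ENNReal.ofReal c₁ ≤ Real.toNNReal (c₁ + c₂) :=
    ENNReal.ofReal_le_ofReal (by linarith)
  have hle₂ : ENNReal.ofReal c₂ ≤ Real.toNNReal (c₁ + c₂) :=
    ENNReal.ofReal_le_ofReal (by linarith)
  have hsub : MartingaleCampanato.pwm P (MartingaleCampanato.bmoN 𝕜 P ℱ) ⊆
      MartingaleCampanato.campanato 𝕜 P ℱ 1 MartingaleCampanato.psi ∩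
        MartingaleCampanato.Linfty 𝕜 P := by
    intro g hg
    obtain ⟨K, hK, hgK⟩ := MartingaleCampanato.exists_bmoNorm_mul_le h0 hg.2
    exact (MartingaleCampanato.mem_campanato_inter_Linfty_of_multiplier hR hsup h0 hgen hreg hK
      hg.2 hgK).1
  refine ⟨hsub.antisymm fun g hg => ⟨hg.2.1, fun f hf =>
    (MartingaleCampanato.mul_mem_bmoN hR h0 hgen hreg hf hg.1 hg.2).1⟩, fun g hg => ⟨?_, ?_⟩⟩
  · refine iSup₂_le fun f hf => iSup_le fun _ => ENNReal.div_le_of_le_mul ?_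
    refine (MartingaleCampanato.mul_mem_bmoN hR h0 hgen hreg hf (hsub hg).1 (hsub hg).2).2.trans ?_
    gcongr
  · set K := MartingaleCampanato.opNorm P (MartingaleCampanato.bmoN 𝕜 P ℱ)
      (MartingaleCampanato.bmoNorm P ℱ) g with hKdef
    -- The infinite case is separated because `toReal` would send it to 0; there the right side is
    -- infinite since the constant is positive.
    by_cases hK : K = ∞
    · rw [hK, ENNReal.mul_top (by exact_mod_cast hpos.ne')]
      exact le_top
    · have hgK : ∀ f ∈ MartingaleCampanato.bmoN 𝕜 P ℱ, MartingaleCampanato.bmoNorm P ℱ (f * g) ≤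
          ENNReal.ofReal K.toReal * MartingaleCampanato.bmoNorm P ℱ f := fun f hf => by
        rw [ENNReal.ofReal_toReal hK]
        exact MartingaleCampanato.bmoNorm_mul_le_opNorm_mul h0 hf g
      refine (MartingaleCampanato.mem_campanato_inter_Linfty_of_multiplier hR hsup h0 hgen hreg
        ENNReal.toReal_nonneg hg.2 hgK).2.trans ?_
      rw [ENNReal.ofReal_toReal hK]
      gcongr
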